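/- **Completeness Theorem (Gödel) for first-order functional logic.** *Signatures.* A signature $S$ of functional logic consists of a set of sorts, among them a distinguished sort $\pi$ (the sort of formulas); a set $V$ of sorts (possibly containing $\pi$) for which variables and quantification are provided; for each $\alpha\in V$ a countably infinite set of variables of sort $\alpha$ (variables of different sorts are different, and variables are different from symbolic operations); and a set of symbolic operations. Each symbolic operation $\mathrm{op}$ has a result sort $\gamma$, a number $m\ge 0$ of argument places, and for each $1\le i\le m$ a sort $\alpha_i$ and a finite sequence $\vec\beta_i$ of sorts in $V$. Among the symbolic operations are $\top,\bot$ (constants of sort $\pi$), $\neg$ and $\to,\wedge,\vee,\leftrightarrow$ (with one, respectively two, arguments of sort $\pi$ and result sort $\pi$), for each $\alpha\in V$ the quantifiers $\forall^\alpha,\exists^\alpha$ (result sort $\pi$, one argument of sort $\pi$, in which one variable of sort $\alpha$ is bound), and for each sort $\alpha$ the equality $=^\alpha$ (result sort $\pi$, two arguments of sort $\alpha$); these symbols are pairwise different, except that $=^\pi$ is $\leftrightarrow$. The expressions of sort $\gamma$ are defined inductively: variables of sort $\gamma$, and $\mathrm{op}((\vec v_1):a_1,\dots,(\vec v_m):a_m)$,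 where $\mathrm{op}$ has result sort $\gamma$, $a_i$ is an expression of sort $\alpha_i$, and $\vec v_i$ is a sequence of pairwise distinct variables of sorts $\vec\beta_i$, which are bound in $a_i$. Formulas are the expressions of sort $\pi$. Free and bound variables and simultaneous substitution $e[\vec x\leftarrow\vec d]$ for the free occurrences of variables are defined as usual. An expression $d$ is substitutable for $x$ in every variable and every constant, and it is substitutable for $x$ in $\mathrm{op}((\vec v_1):a_1,\dots)$ iff for each $i$ either $x$ is in $\vec v_i$, or $d$ is substitutable for $x$ in $a_i$ and no free variable of $d$ is in $\vec v_i$. *Structures.* An $\mathrm{Fnl}$-structure $M$ of signature $S$ assigns to each sort $\gamma$ a non-empty set $M_\gamma$, to each sort $\gamma$ and each finite sequence $\vec\sigma$ of sorts in $V$ a set $M_\gamma^{\vec\sigma}$ of functions $\prod_i M_{\sigma_i}\to M_\gamma$ (with $M_\gamma^{\langle\rangle}=M_\gamma$), and to each $\mathrm{op}$ as above an element of $M_\gamma$ if $m=0$ and a function $M(\mathrm{op}):\prod_{i} M_{\alpha_i}^{\vec\beta_i}\to M_\gamma$ if $m>0$. The sets $M_\gamma^{\vec\sigma}$ contain the constant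 functions and the projections, are closed under fixing an initial segment of the arguments (if $g\in M_\gamma^{\vec\sigma\vec\varrho}$ and $\vec x\in\prod_i M_{\sigma_i}$, then $\vec r\mapsto g(\vec x\,\vec r)$ is in $M_\gamma^{\vec\varrho}$) and under composition with each $M(\mathrm{op})$ (if $g_i\in M_{\alpha_i}^{\vec\sigma\vec\beta_i}$ for all $i$, then $\vec y\mapsto M(\mathrm{op})\big((\vec z\mapsto g_i(\vec y\,\vec z))_i\big)$ is in $M_\gamma^{\vec\sigma}$). Moreover $M_\pi=\{M(\bot),M(\top)\}$ has two elements, the connectives are interpreted by the truth functions, $\forall^\alpha$ and $\exists^\alpha$ by "for all elements" and "for some element" of $M_\alpha$, and $=^\alpha$ by identity. For an expression $e$ of sort $\gamma$ and a sequence $\vec u$ of variables of sorts $\vec\sigma$ that contains all the free variables of $e$, the value $e_M(\vec u)\in M_\gamma^{\vec\sigma}$ is defined by recursion on $e$: a variable is evaluated by the projection to its rightmost place in $\vec u$, and $\mathrm{op}((\vec v_1):a_1,\dots,(\vec v_m):a_m)$ by $\vec x\mapsto M(\mathrm{op})\big((\vec z\mapsto (a_i)_M(\vec u\,\vec v_i)(\vec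 x\,\vec z))_i\big)$. $M$ is a model of a formula $\varphi$ if $\varphi_M(\vec u)$ is constantly $M(\top)$ for each such $\vec u$; it is a model of a set of formulas if it is a model of each of its members. *The calculus $K_F$.* The axioms are, for all formulas $\varphi,\psi$ and all variables $x$: the propositional tautologies; $\forall x\,\varphi\to\varphi[x\leftarrow a]$ and $\varphi[x\leftarrow a]\to\exists x\,\varphi$ for every expression $a$ of the sort of $x$ that is substitutable for $x$ in $\varphi$; $\forall x(\psi\to\varphi)\to(\psi\to\forall x\,\varphi)$ and $\forall x(\varphi\to\psi)\to(\exists x\,\varphi\to\psi)$ if $x$ is not free in $\psi$; (I1) $a=a$ for every expression $a$; and (I2) $$\forall\vec z\,\big(b_1[\vec x\leftarrow\vec z]=b_2[\vec y\leftarrow\vec z]\big)\to \mathrm{op}(\Delta,(\vec x):b_1,\Gamma)=\mathrm{op}(\Delta,(\vec y):b_2,\Gamma)$$ for every symbolic operation $\mathrm{op}$ and each of its argument places $i$, where $b_1,b_2$ are expressions of sort $\alpha_i$, each of $\vec x,\vec y,\vec z$ is a sequence of pairwise distinct variables of sorts $\vec\beta_i$, no member of $\vec z$ occurs (free or bound)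 in $b_1$ or $b_2$, and $\Delta,\Gamma$ stand for the other arguments, which are the same on both sides. The rules are modus ponens (from $\varphi$ and $\varphi\to\psi$ infer $\psi$) and generalization (from $\varphi$ infer $\forall x\,\varphi$). A formula is derivable from $T$ if it can be obtained by the rules from the axioms and the members of $T$. *Theorem.* Let $S$ be a signature of functional logic, $T$ a set of formulas of $S$ and $\varphi$ a formula of $S$. If every $\mathrm{Fnl}$-structure of signature $S$ that is a model of $T$ is also a model of $\varphi$, then $\varphi$ is derivable from $T$ in $K_F$. -/

import Mathlib

universe u

namespace Fnl

/-- The sorts of a signature: the distinguished sort `prop` of formulas and the other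
(individual) sorts, listed by `I`. -/
inductive FSort (I : Type u) : Type u
  | prop : FSort I
  | ind (i : I) : FSort I

/-- The value of the signature map at a symbol: the sort `res` of the resulting expressions, the
number `len` of argument places, and for each place the sort `arg i` of the argument and the
sequence `bnd i` of the sorts of the variables which the symbol binds in that argument. -/
structure Rank (Srt : Type u) (V : Set Srt) : Type u where
  res : Srt
  len : ℕ
  arg : Fin len → Srt
  bnd : Fin len → List V

/-- A signature of first-order functional logic. `VSrt` is the set of the sorts for which there are
variables and quantifiers, `Var α` is the (countably infinite) set of the variables of sort `α`,
and `Op` is the set of the symbols other than the variables and the logical symbols. -/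
structure Signature : Type (u + 1) where
  ISrt : Type u
  VSrt : Set (FSort ISrt)
  Var : VSrt → Type u
  var_infinite : ∀ α, Infinite (Var α)
  var_countable : ∀ α, Countable (Var α)
  Op : Type u
  opRank : Op → Rank (FSort ISrt) VSrt

/-- All the sorts of `S`. -/
abbrev Signature.Srt (S : Signature.{u}) : Type u := FSort S.ISrt

/-- All the variables of `S`, each together with its sort. -/
abbrev Signature.AVar (S : Signature.{u}) : Type u := Σ α : S.VSrt, S.Var α

/-- The symbolic operations of `S`: the logical symbols and the elements of `S.Op`.
The equality symbol of the sort `prop` is `iff`, so `eq` is needed for the other sorts only. -/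
inductive Sym (S : Signature.{u}) : Type u
  | verum : Sym S
  | falsum : Sym S
  | neg : Sym S
  | imp : Sym S
  | and : Sym S
  | or : Sym S
  | iff : Sym S
  | all (α : S.VSrt) : Sym S
  | ex (α : S.VSrt) : Sym S
  | eq (i : S.ISrt) : Sym S
  | op (f : S.Op) : Sym S

/-- The signature map on the symbolic operations. -/
@[reducible] def Sym.rank {S : Signature.{u}} : Sym S → Rank S.Srt S.VSrt
  | .verum => ⟨.prop, 0, fun _ => .prop, fun _ => []⟩
  | .falsum => ⟨.prop, 0, fun _ => .prop, fun _ => []⟩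
  | .neg => ⟨.prop, 1, fun _ => .prop, fun _ => []⟩
  | .imp => ⟨.prop, 2, fun _ => .prop, fun _ => []⟩
  | .and => ⟨.prop, 2, fun _ => .prop, fun _ => []⟩
  | .or => ⟨.prop, 2, fun _ => .prop, fun _ => []⟩
  | .iff => ⟨.prop, 2, fun _ => .prop, fun _ => []⟩
  | .all α => ⟨.prop, 1, fun _ => .prop, fun _ => [α]⟩
  | .ex α => ⟨.prop, 1, fun _ => .prop, fun _ => [α]⟩
  | .eq i => ⟨.prop, 2, fun _ => .ind i, fun _ => []⟩
  | .op f => S.opRank f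

/-! ### Finite sequences whose members have prescribed sorts -/

/-- `Tup A [i₁, …, iₗ]` is the product `A i₁ × … × A iₗ` (a one-point set for `l = 0`). -/
inductive Tup {ι : Type u} (A : ι → Type u) : List ι → Type u
  | nil : Tup A []
  | cons {i : ι} {l : List ι} (a : A i) (x : Tup A l) : Tup A (i :: l)

namespace Tup

variable {ι : Type u} {A B : ι → Type u}

/-- The sequence with one member. -/
@[reducible] def single {i : ι} (a : A i) : Tup A [i] := cons a nil

/-- The members of a sequence, each together with its sort. -/
def toList : {l : List ι} → Tup A l → List (Σ i, A i)
  | _, nil => []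
  | _, cons a x => ⟨_, a⟩ :: toList x

/-- The `j`-th member. -/
def get : {l : List ι} → Tup A l → (j : Fin l.length) → A (l.get j)
  | _, cons a _, ⟨0, _⟩ => a
  | _, cons _ x, ⟨j + 1, h⟩ => get x ⟨j, Nat.lt_of_succ_lt_succ h⟩

/-- Concatenation. -/
def append : {l k : List ι} → Tup A l → Tup A k → Tup A (l ++ k)
  | _, _, nil, y => y
  | _, _, cons a x, y => cons a (append x y)

/-- Apply a sort-preserving map to each member. -/
def map (f : ∀ i, A i → B i) : {l : List ι} → Tup A l → Tup B l
  | _, nil => nil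
  | _, cons a x => cons (f _ a) (map f x)

open Classical in
/-- The function `θ` changed to take the value `d` at the point `a` of sort `i`. -/
noncomputable def update (θ : ∀ w : Σ i, A i, B w.1) {i : ι} (a : A i) (d : B i) :
    ∀ w : Σ i, A i, B w.1 :=
  Function.update θ ⟨i, a⟩ d

theorem update_self (θ : ∀ w : Σ i, A i, B w.1) {i : ι} (a : A i) (d : B i) :
    update θ a d ⟨i, a⟩ = d := by
  simp [update]

theorem update_of_ne (θ : ∀ w : Σ i, A i, B w.1) {i : ι} (a : A i) (d : B i) {w : Σ i, A i}
    (h : w ≠ ⟨i, a⟩) : update θ a d w = θ w := by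
  simp [update, h]

/-- The function `θ` changed to take the value `d_j` at `x_j` for all `j`. If a point occurs more
than once among the `x_j`, then its rightmost occurrence decides. -/
noncomputable def overwrite : {l : List ι} → (∀ w : Σ i, A i, B w.1) → Tup A l → Tup B l →
    ∀ w : Σ i, A i, B w.1
  | _, θ, nil, nil => θ
  | _, θ, cons a x, cons b d => overwrite (update θ a b) x d

/-- At each point, overwriting either picks a fixed member of the second sequence or does
nothing. -/
theorem overwrite_cases : ∀ {l : List ι} (x : Tup A l) (w : Σ i, A i),
    (∃ (j : Fin l.length) (h : l.get j = w.1), ∀ (θ : ∀ w : Σ i, A i, B w.1) (d : Tup B l),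
      overwrite θ x d w = h ▸ d.get j) ∨
    (∀ (θ : ∀ w : Σ i, A i, B w.1) (d : Tup B l), overwrite θ x d w = θ w)
  | _, nil, _ => Or.inr fun _ d => by cases d; rfl
  | _, @cons _ _ i l a x, w => by
    rcases overwrite_cases x w with ⟨j, h, hj⟩ | h0
    · refine Or.inl ⟨j.succ, h, fun θ d => ?_⟩
      cases d
      exact hj _ _
    · by_cases hw : w = ⟨i, a⟩
      · subst hw
        refine Or.inl ⟨⟨0, Nat.succ_pos _⟩, rfl, fun θ d => ?_⟩
        cases d
        exact (h0 _ _).trans (update_self _ _ _)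
      · refine Or.inr fun θ d => ?_
        cases d
        exact (h0 _ _).trans (update_of_ne _ _ _ hw)

end Tup

/-! ### Expressions -/

/-- The expressions of each sort: the variables, and `o((v₁) : a₁, …, (vₘ) : aₘ)` for a symbolic
operation `o`, where `vᵢ` is a sequence of pairwise distinct variables binding the argument
`aᵢ` (just `o` for `m = 0`). -/
inductive Expr (S : Signature.{u}) : S.Srt → Type u
  | var (α : S.VSrt) (x : S.Var α) : Expr S α.1
  | app (o : Sym S) (v : ∀ i : Fin o.rank.len, Tup S.Var (o.rank.bnd i))
      (hv : ∀ i, (v i).toList.Nodup) (a : ∀ i : Fin o.rank.len, Expr S (o.rank.arg i)) :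
      Expr S o.rank.res

/-- Formulas are the expressions of sort `prop`. -/
abbrev Formula (S : Signature.{u}) : Type u := Expr S .prop

namespace Expr

variable {S : Signature.{u}}

/-- Free variables. -/
def fv : {γ : S.Srt} → Expr S γ → Set S.AVar
  | _, var α x => {⟨α, x⟩}
  | _, app _ v _ a => ⋃ i, fv (a i) \ {w | w ∈ (v i).toList}

/-- Bound variables. -/
def bv : {γ : S.Srt} → Expr S γ → Set S.AVar
  | _, var _ _ => ∅
  | _, app _ v _ a => ⋃ i, bv (a i) ∪ {w | w ∈ (v i).toList}

/-- The variables of a sequence, as a sequence of expressions. -/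
def vars {σ : List S.VSrt} (v : Tup S.Var σ) : Tup (fun α : S.VSrt => Expr S α.1) σ :=
  v.map var

/-- `e.subst θ` is the result of simultaneously replacing in `e` each free occurrence of each
variable `w` by `θ w`: within the scope of binding variables `v`, the replacement `θ` is changed
so as to leave the members of `v` as they are. -/
noncomputable def subst : {γ : S.Srt} → Expr S γ → (∀ w : S.AVar, Expr S w.1.1) → Expr S γ
  | _, var α x, θ => θ ⟨α, x⟩
  | _, app o v hv a, θ =>
      app o v hv fun i =>
        subst (a i) (Tup.overwrite (B := fun α : S.VSrt => Expr S α.1) θ (v i) (vars (v i)))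

/-- The substitution `e[x ← d]` of a sequence of expressions for a sequence of variables. -/
noncomputable def substSeq {γ : S.Srt} (e : Expr S γ) {σ : List S.VSrt} (x : Tup S.Var σ)
    (d : Tup (fun α : S.VSrt => Expr S α.1) σ) : Expr S γ :=
  e.subst (Tup.overwrite (B := fun α : S.VSrt => Expr S α.1) (fun w => var w.1 w.2) x d)

/-- The substitution `e[x ← d]` of one expression for one variable. -/
noncomputable def substOne {γ : S.Srt} (e : Expr S γ) {α : S.VSrt} (x : S.Var α)
    (d : Expr S α.1) : Expr S γ :=
  e.substSeq (Tup.single x) (Tup.single d)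

/-- `Substitutable d x e`: the expression `d` is substitutable for the variable `x` in `e`. -/
def Substitutable {δ : S.Srt} (d : Expr S δ) (x : S.AVar) : {γ : S.Srt} → Expr S γ → Prop
  | _, var _ _ => True
  | _, app _ v _ a => ∀ i, x ∈ (v i).toList ∨
      (Substitutable d x (a i) ∧ d.fv ∩ {w | w ∈ (v i).toList} = ∅)

/-! Logical symbols applied to arguments. -/

/-- `⊤` -/
def verum : Formula S :=
  app .verum (fun _ => Tup.nil) (fun _ => List.nodup_nil) (fun i => i.elim0)

/-- `⊥` -/
def falsum : Formula S :=
  app .falsum (fun _ => Tup.nil) (fun _ => List.nodup_nil) (fun i => i.elim0)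

/-- `¬φ` -/
def neg (φ : Formula S) : Formula S :=
  app .neg (fun _ => Tup.nil) (fun _ => List.nodup_nil) (fun _ => φ)

/-- `φ → ψ` -/
def imp (φ ψ : Formula S) : Formula S :=
  app .imp (fun _ => Tup.nil) (fun _ => List.nodup_nil) ![φ, ψ]

/-- `φ ∧ ψ` -/
def and (φ ψ : Formula S) : Formula S :=
  app .and (fun _ => Tup.nil) (fun _ => List.nodup_nil) ![φ, ψ]

/-- `φ ∨ ψ` -/
def or (φ ψ : Formula S) : Formula S :=
  app .or (fun _ => Tup.nil) (fun _ => List.nodup_nil) ![φ, ψ]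

/-- `φ ↔ ψ` -/
def iff (φ ψ : Formula S) : Formula S :=
  app .iff (fun _ => Tup.nil) (fun _ => List.nodup_nil) ![φ, ψ]

/-- `∀ x, φ` -/
def all {α : S.VSrt} (x : S.Var α) (φ : Formula S) : Formula S :=
  app (.all α) (fun _ => Tup.single x) (fun _ => List.nodup_singleton _) (fun _ => φ)

/-- `∃ x, φ` -/
def ex {α : S.VSrt} (x : S.Var α) (φ : Formula S) : Formula S :=
  app (.ex α) (fun _ => Tup.single x) (fun _ => List.nodup_singleton _) (fun _ => φ)

/-- `a = b`, which is `a ↔ b` for formulas `a`, `b`. -/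
def equal : {γ : S.Srt} → Expr S γ → Expr S γ → Formula S
  | .prop, a, b => iff a b
  | .ind i, a, b => app (.eq i) (fun _ => Tup.nil) (fun _ => List.nodup_nil) ![a, b]

/-- `∀ z₁, …, ∀ zᵣ, φ` -/
def allSeq : {σ : List S.VSrt} → Tup S.Var σ → Formula S → Formula S
  | _, .nil, φ => φ
  | _, .cons x z, φ => all x (allSeq z φ)

end Expr

/-! ### Structures -/

/-- The data of a structure with their closure properties, before the logical symbols get their
meaning. `Fn γ σ` is the selected set of functions from the product of the ranges of the sorts `σ`
to the range of `γ`. For empty `σ` these are all the functions from a one-point set, that is, the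
elements of the range of `γ`. -/
structure PreStructure (S : Signature.{u}) : Type (u + 1) where
  carrier : S.Srt → Type u
  carrier_nonempty : ∀ γ, Nonempty (carrier γ)
  Fn : ∀ (γ : S.Srt) (σ : List S.VSrt),
    Set (Tup (fun α : S.VSrt => carrier α.1) σ → carrier γ)
  fn_nil : ∀ γ, Fn γ [] = Set.univ
  interp : ∀ o : Sym S, (∀ i : Fin o.rank.len, Fn (o.rank.arg i) (o.rank.bnd i)) →
    carrier o.rank.res
  /-- Constant functions. -/
  const_mem : ∀ (γ : S.Srt) (σ : List S.VSrt) (w : carrier γ), (fun _ => w) ∈ Fn γ σ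
  /-- Projections. -/
  proj_mem : ∀ (σ : List S.VSrt) (j : Fin σ.length), (fun x => x.get j) ∈ Fn (σ.get j).1 σ
  /-- Partial fixing. -/
  fix_mem : ∀ (γ : S.Srt) (σ ρ : List S.VSrt) (x : Tup (fun α : S.VSrt => carrier α.1) σ),
    ∀ g ∈ Fn γ (σ ++ ρ), (fun r => g (x.append r)) ∈ Fn γ ρ
  /-- Composition with the interpretation of a symbol. -/
  comp_mem : ∀ (σ : List S.VSrt) (o : Sym S)
    (g : ∀ i : Fin o.rank.len, Fn (o.rank.arg i) (σ ++ o.rank.bnd i)),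
    (fun y => interp o fun i =>
      ⟨fun z => (g i).1 (y.append z), fix_mem _ _ _ y _ (g i).2⟩) ∈ Fn o.rank.res σ

namespace PreStructure

variable {S : Signature.{u}}

/-- The value of `⊤`. -/
def tt (M : PreStructure S) : M.carrier .prop := M.interp .verum fun i => i.elim0

/-- The value of `⊥`. -/
def ff (M : PreStructure S) : M.carrier .prop := M.interp .falsum fun i => i.elim0

end PreStructure

/-- A normal structure of functional logic. The range of `prop` is the two-element Boolean algebra,
and the logical symbols have their fixed meaning. -/
structure Structure (S : Signature.{u}) : Type (u + 1) extends PreStructure S where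
  tt_ne_ff : toPreStructure.tt ≠ toPreStructure.ff
  eq_tt_or_ff : ∀ p : carrier .prop, p = toPreStructure.tt ∨ p = toPreStructure.ff
  interp_neg : ∀ p : Fin 1 → Fn .prop [],
    interp .neg p = toPreStructure.tt ↔ ¬ (p 0).1 Tup.nil = toPreStructure.tt
  interp_imp : ∀ p : Fin 2 → Fn .prop [],
    interp .imp p = toPreStructure.tt ↔
      ((p 0).1 Tup.nil = toPreStructure.tt → (p 1).1 Tup.nil = toPreStructure.tt)
  interp_and : ∀ p : Fin 2 → Fn .prop [],
    interp .and p = toPreStructure.tt ↔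
      ((p 0).1 Tup.nil = toPreStructure.tt ∧ (p 1).1 Tup.nil = toPreStructure.tt)
  interp_or : ∀ p : Fin 2 → Fn .prop [],
    interp .or p = toPreStructure.tt ↔
      ((p 0).1 Tup.nil = toPreStructure.tt ∨ (p 1).1 Tup.nil = toPreStructure.tt)
  interp_iff : ∀ p : Fin 2 → Fn .prop [],
    interp .iff p = toPreStructure.tt ↔
      ((p 0).1 Tup.nil = toPreStructure.tt ↔ (p 1).1 Tup.nil = toPreStructure.tt)
  interp_all : ∀ (α : S.VSrt) (p : Fin 1 → Fn .prop [α]),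
    interp (.all α) p = toPreStructure.tt ↔
      ∀ x : carrier α.1, (p 0).1 (Tup.single x) = toPreStructure.tt
  interp_ex : ∀ (α : S.VSrt) (p : Fin 1 → Fn .prop [α]),
    interp (.ex α) p = toPreStructure.tt ↔
      ∃ x : carrier α.1, (p 0).1 (Tup.single x) = toPreStructure.tt
  interp_eq : ∀ (i : S.ISrt) (p : Fin 2 → Fn (.ind i) []),
    interp (.eq i) p = toPreStructure.tt ↔ (p 0).1 Tup.nil = (p 1).1 Tup.nil

namespace PreStructure

variable {S : Signature.{u}} (M : PreStructure S)

/-- The value of the variable `w` if the members of `u` have the values `y` (the rightmost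
occurrence of `w` in `u` decides). If `w` is not in `u`, it is an arbitrary constant. -/
noncomputable def varVal {σ : List S.VSrt} (u : Tup S.Var σ) (w : S.AVar)
    (y : Tup (fun α : S.VSrt => M.carrier α.1) σ) : M.carrier w.1.1 :=
  Tup.overwrite (B := fun α : S.VSrt => M.carrier α.1)
    (fun w => Classical.choice (M.carrier_nonempty w.1.1)) u y w

theorem varVal_mem {σ : List S.VSrt} (u : Tup S.Var σ) (w : S.AVar) :
    M.varVal u w ∈ M.Fn w.1.1 σ := by
  obtain ⟨α, x⟩ := w
  rcases Tup.overwrite_cases (B := fun α : S.VSrt => M.carrier α.1) u ⟨α, x⟩ with ⟨j, h, hj⟩ | h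
  · dsimp only at h
    subst h
    have : M.varVal u ⟨σ.get j, x⟩ = fun y => y.get j := funext fun y => hj _ y
    rw [this]
    exact M.proj_mem σ j
  · have : M.varVal u ⟨α, x⟩ = fun _ => Classical.choice (M.carrier_nonempty α.1) :=
      funext fun y => h _ y
    rw [this]
    exact M.const_mem _ _ _

/-- The evaluation of an expression `e` at a sequence `u` of variables of sorts `σ`: the function
that gives the value of `e` in terms of the values of the members of `u`. It is meant for the
sequences `u` that contain all the free variables of `e`. -/
noncomputable def eval : {γ : S.Srt} → Expr S γ → (σ : List S.VSrt) → Tup S.Var σ → M.Fn γ σ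
  | _, .var α x, _, u => ⟨M.varVal u ⟨α, x⟩, M.varVal_mem u ⟨α, x⟩⟩
  | _, .app o v _ a, σ, u =>
      ⟨fun y => M.interp o fun i =>
          ⟨fun z => (eval (a i) (σ ++ o.rank.bnd i) (u.append (v i))).1 (y.append z),
            M.fix_mem _ _ _ y _ (eval (a i) (σ ++ o.rank.bnd i) (u.append (v i))).2⟩,
        M.comp_mem σ o fun i => eval (a i) (σ ++ o.rank.bnd i) (u.append (v i))⟩

/-- `M` is a model of the formula `φ`: for each sequence `u` of variables that contains all the
free variables of `φ`, the evaluation of `φ` at `u` is constantly true. -/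
def Models (φ : Formula S) : Prop :=
  ∀ (σ : List S.VSrt) (u : Tup S.Var σ), (∀ w ∈ φ.fv, w ∈ u.toList) →
    ∀ y : Tup (fun α : S.VSrt => M.carrier α.1) σ, (M.eval φ σ u).1 y = M.tt

end PreStructure

/-- Semantic consequence: each structure that is a model of all members of `T` is a model
of `φ`. -/
def Entails {S : Signature.{u}} (T : Set (Formula S)) (φ : Formula S) : Prop :=
  ∀ M : Structure.{u} S, (∀ ψ ∈ T, M.Models ψ) → M.Models φ

/-! ### The calculus -/

/-- A truth assignment to all the formulas that respects the propositional connectives. -/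
structure IsValuation {S : Signature.{u}} (V : Formula S → Prop) : Prop where
  verum : V .verum
  falsum : ¬ V .falsum
  neg : ∀ φ, V φ.neg ↔ ¬ V φ
  imp : ∀ φ ψ, V (φ.imp ψ) ↔ (V φ → V ψ)
  and : ∀ φ ψ, V (φ.and ψ) ↔ (V φ ∧ V ψ)
  or : ∀ φ ψ, V (φ.or ψ) ↔ (V φ ∨ V ψ)
  iff : ∀ φ ψ, V (φ.iff ψ) ↔ (V φ ↔ V ψ)

/-- Propositional tautologies. -/
def Tautology {S : Signature.{u}} (φ : Formula S) : Prop :=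
  ∀ V : Formula S → Prop, IsValuation V → V φ

/-- Derivability from `T` in the calculus of functional logic. -/
inductive Derivable {S : Signature.{u}} (T : Set (Formula S)) : Formula S → Prop
  | premise (φ : Formula S) : φ ∈ T → Derivable T φ
  | taut (φ : Formula S) : Tautology φ → Derivable T φ
  | all_elim {α : S.VSrt} (x : S.Var α) (a : Expr S α.1) (φ : Formula S) :
      a.Substitutable ⟨α, x⟩ φ → Derivable T ((Expr.all x φ).imp (φ.substOne x a))
  | ex_intro {α : S.VSrt} (x : S.Var α) (a : Expr S α.1) (φ : Formula S) :
      a.Substitutable ⟨α, x⟩ φ → Derivable T ((φ.substOne x a).imp (Expr.ex x φ))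
  | all_imp {α : S.VSrt} (x : S.Var α) (ψ φ : Formula S) : ⟨α, x⟩ ∉ ψ.fv →
      Derivable T ((Expr.all x (ψ.imp φ)).imp (ψ.imp (Expr.all x φ)))
  | ex_imp {α : S.VSrt} (x : S.Var α) (ψ φ : Formula S) : ⟨α, x⟩ ∉ ψ.fv →
      Derivable T ((Expr.all x (φ.imp ψ)).imp ((Expr.ex x φ).imp ψ))
  /-- Reflexivity: `a = a`. -/
  | eq_refl {γ : S.Srt} (a : Expr S γ) : Derivable T (a.equal a)
  /-- Congruence: `(∀ z, b₁[x ← z] = b₂[y ← z]) → o(…, (x) : b₁, …) = o(…, (y) : b₂, …)`, where the two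
  sides of the conclusion differ only in the `i`-th argument place (`b₁ = a i`, `x = v i`,
  `b₂ = b i`, `y = w i`) and `z` is a sequence of pairwise distinct variables that do not occur
  in `b₁` or `b₂`. -/
  | eq_congr (o : Sym S) (v w : ∀ i : Fin o.rank.len, Tup S.Var (o.rank.bnd i))
      (hv : ∀ i, (v i).toList.Nodup) (hw : ∀ i, (w i).toList.Nodup)
      (a b : ∀ i : Fin o.rank.len, Expr S (o.rank.arg i)) (i : Fin o.rank.len)
      (hother : ∀ j, j ≠ i → v j = w j ∧ a j = b j)
      (z : Tup S.Var (o.rank.bnd i)) (hz : z.toList.Nodup)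
      (hfree : ∀ t ∈ z.toList, t ∉ (a i).fv ∪ (b i).fv)
      (hbound : ∀ t ∈ z.toList, t ∉ (a i).bv ∪ (b i).bv) :
      Derivable T ((Expr.allSeq z (((a i).substSeq (v i) (Expr.vars z)).equal
          ((b i).substSeq (w i) (Expr.vars z)))).imp
        ((Expr.app o v hv a).equal (Expr.app o w hw b)))
  | mp (φ ψ : Formula S) : Derivable T φ → Derivable T (φ.imp ψ) → Derivable T ψ
  | gen {α : S.VSrt} (x : S.Var α) (φ : Formula S) : Derivable T φ → Derivable T (Expr.all x φ)

end Fnl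

/-!
The proof is Henkin's. Suppose that `φ` is not derivable from `T`. The language is enlarged by a
constant for each existential formula, the formulas are decided by a maximal consistent set, and the
closed expressions, identified if their equation is in that set, make up a model of `T` which is not
a model of `φ`.

*Constants.* The expressions `HExpr` have, besides the constructors of `Expr`, a constant
`wit α x φ` for each variable `x` and each formula `φ` of the enlarged language itself. So one step
suffices instead of a sequence of extensions, and the constants come with a well-founded rank, the
size of their index. There is no calculus for the enlarged language: `HDerivable T φ` says that the
formulas which arise from `φ` when its constants are replaced by variables are derivable from `T`,
for all replacements that avoid some finite set of variables. Derivability under all of them,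
injective or not, is preserved by the few rules that are needed, and leaves open which replacement
to use later. For the formulas of the original language, `HDerivable` is derivability
(`hDerivable_ofExpr_iff`).

*Henkin axioms.* In a derivation from finitely many axioms `∃ x, φ → φ[x ← wit α x φ]`, the constant
whose index is largest does not occur in the others. It may be replaced by a fresh variable, and
the axiom drops out (`HDerivable.of_henkin_imp`, `HDerivable.of_foldr_henkin`). This uses the
renaming of bound variables, which is obtained from the congruence axiom (`Derivable.ex_rename`),
since the condition of substitutability in the quantifier axioms is too strict for it. The lemma of
Teichmüller and Tukey then yields a truth assignment to the enlarged formulas that respects the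
connectives and makes the derivable formulas and the Henkin axioms true (`exists_isHenkin`).

*The structure.* The range of a sort consists of the classes of its closed expressions, and the
selected functions are those represented by an expression `e` with a sequence of variables `v`. The
value of a symbol `o` at functions represented by `eᵢ`, `vᵢ` is the class of `o((v₁) : e₁, …)`. That
this class depends on the functions only is the point where the congruence axiom is needed: if
`eᵢ`, `vᵢ` and `eᵢ'`, `vᵢ'` represent the same function, then, since each universal statement with
only true instances is true, the premise of the axiom is true (`IsHenkin.app_congr`). Closure of the
functions under composition holds because the variables can be renamed so as not to get bound.
A sort without variables may have no closed expressions; its range is a one-point set.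
Evaluation in this structure is substitution (`IsHenkin.eval_termStructure`).
-/

namespace Fnl

/-! ### Sequences and overwriting -/

namespace Tup

variable {ι : Type u} {A B C : ι → Type u}

theorem overwrite_of_notMem : ∀ {l : List ι} (x : Tup A l) (θ : ∀ w : Σ i, A i, B w.1)
    (d : Tup B l) {w : Σ i, A i}, w ∉ x.toList → overwrite θ x d w = θ w
  | _, nil, _, nil, _, _ => rfl
  | _, cons a x, θ, cons b d, w, h => by
    simp only [toList, List.mem_cons, not_or] at h
    rw [overwrite, overwrite_of_notMem x _ d h.2, update_of_ne _ _ _ h.1]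

theorem overwrite_congr : ∀ {l : List ι} (x : Tup A l) (θ θ' : ∀ w : Σ i, A i, B w.1)
    (d : Tup B l) {w : Σ i, A i}, (w ∉ x.toList → θ w = θ' w) →
    overwrite θ x d w = overwrite θ' x d w
  | _, nil, _, _, nil, _, h => h (by simp [toList])
  | _, @cons _ _ i _ a x, θ, θ', cons b d, w, h => by
    rw [overwrite, overwrite]
    refine overwrite_congr x _ _ d fun hx => ?_
    by_cases hw : w = ⟨i, a⟩
    · subst hw; rw [update_self, update_self]
    · rw [update_of_ne _ _ _ hw, update_of_ne _ _ _ hw]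
      exact h (by simp [toList, hw, hx])

theorem overwrite_map_self (f : ∀ i, A i → B i) : ∀ {l : List ι} (x : Tup A l)
    (θ : ∀ w : Σ i, A i, B w.1) {w : Σ i, A i}, w ∈ x.toList →
    overwrite θ x (x.map f) w = f w.1 w.2
  | _, nil, _, _, h => by simp [toList] at h
  | _, @cons _ _ i _ a x, θ, w, h => by
    rw [map, overwrite]
    by_cases hx : w ∈ x.toList
    · exact overwrite_map_self f x _ hx
    · have hw : w = ⟨i, a⟩ := by simpa [toList, hx] using h
      rw [overwrite_of_notMem x _ _ hx, hw, update_self]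

theorem overwrite_append : ∀ {l k : List ι} (x : Tup A l) (y : Tup A k)
    (θ : ∀ w : Σ i, A i, B w.1) (d : Tup B l) (c : Tup B k),
    overwrite θ (x.append y) (d.append c) = overwrite (overwrite θ x d) y c
  | _, _, nil, _, _, nil, _ => rfl
  | _, _, cons _ x, y, _, cons _ d, c => overwrite_append x y _ d c

theorem overwrite_single_self (θ : ∀ w : Σ i, A i, B w.1) {i : ι} (a : A i) (b : B i) :
    overwrite θ (single a) (single b) ⟨i, a⟩ = b :=
  update_self θ a b

theorem overwrite_single_of_ne (θ : ∀ w : Σ i, A i, B w.1) {i : ι} (a : A i) (b : B i)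
    {w : Σ i, A i} (h : w ≠ ⟨i, a⟩) : overwrite θ (single a) (single b) w = θ w :=
  update_of_ne θ a b h

/-- Overwriting is natural in the values. -/
theorem apply_overwrite (F : ∀ i, B i → C i) : ∀ {l : List ι} (x : Tup A l)
    (θ : ∀ w : Σ i, A i, B w.1) (d : Tup B l) (w : Σ i, A i),
    F w.1 (overwrite θ x d w) = overwrite (fun w => F w.1 (θ w)) x (d.map F) w
  | _, nil, _, nil, _ => rfl
  | _, @cons _ _ i _ a x, θ, cons b d, w => by
    rw [overwrite, map, overwrite, apply_overwrite F x]
    congr 1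
    funext w
    by_cases hw : w = ⟨i, a⟩
    · subst hw; rw [update_self, update_self]
    · rw [update_of_ne _ _ _ hw, update_of_ne _ _ _ hw]

theorem overwrite_of_mem (P : ∀ i, B i → Prop) : ∀ {l : List ι} (x : Tup A l)
    (θ : ∀ w : Σ i, A i, B w.1) (d : Tup B l), (∀ b ∈ d.toList, P b.1 b.2) →
    ∀ {w : Σ i, A i}, w ∈ x.toList → P w.1 (overwrite θ x d w)
  | _, nil, _, _, _, _, h => by simp [toList] at h
  | _, @cons _ _ i _ a x, θ, cons b d, hd, w, h => by
    simp only [toList, List.forall_mem_cons] at hd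
    by_cases hx : w ∈ x.toList
    · exact overwrite_of_mem P x _ d hd.2 hx
    · have hw : w = ⟨i, a⟩ := by simpa [toList, hx] using h
      rw [overwrite, overwrite_of_notMem x _ _ hx, hw, update_self]
      exact hd.1

theorem forall_mem_toList_map (f : ∀ i, A i → B i) (P : (Σ i, B i) → Prop) :
    ∀ {l : List ι} (x : Tup A l), (∀ w ∈ x.toList, P ⟨w.1, f w.1 w.2⟩) →
    ∀ b ∈ (x.map f).toList, P b
  | _, nil, _, _, hb => by simp [map, toList] at hb
  | _, cons a x, h, b, hb => by
    simp only [map, toList, List.mem_cons] at hb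
    rw [toList, List.forall_mem_cons] at h
    rcases hb with rfl | hb
    · exact h.1
    · exact forall_mem_toList_map f P x h.2 b hb

/-- Without repetitions among the points, overwriting and then looking up the points gives back
the sequence of values. -/
theorem map_overwrite_self : ∀ {l : List ι} (x : Tup A l) (θ : ∀ w : Σ i, A i, B w.1)
    (d : Tup B l), x.toList.Nodup → x.map (fun i a => overwrite θ x d ⟨i, a⟩) = d
  | _, nil, _, nil, _ => rfl
  | _, @cons _ _ i _ a x, θ, cons b d, h => by
    rw [toList, List.nodup_cons] at h
    rw [map]
    congr 1
    · rw [overwrite, overwrite_of_notMem x _ d h.1, update_self]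
    · exact map_overwrite_self x _ d h.2

theorem map_map (f : ∀ i, A i → B i) (g : ∀ i, B i → C i) : ∀ {l : List ι} (x : Tup A l),
    (x.map f).map g = x.map fun i a => g i (f i a)
  | _, nil => rfl
  | _, cons a x => by rw [map, map, map, map_map f g x]

theorem map_append (f : ∀ i, A i → B i) : ∀ {l k : List ι} (x : Tup A l) (y : Tup A k),
    (x.append y).map f = (x.map f).append (y.map f)
  | _, _, nil, _ => rfl
  | _, _, cons a x, y => by rw [append, map, map, append, map_append f x y]

theorem get_map (f : ∀ i, A i → B i) : ∀ {l : List ι} (x : Tup A l) (j : Fin l.length),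
    (x.map f).get j = f _ (x.get j)
  | _, cons _ _, ⟨0, _⟩ => rfl
  | _, cons _ x, ⟨j + 1, h⟩ => get_map f x ⟨j, Nat.lt_of_succ_lt_succ h⟩

theorem toList_append : ∀ {l k : List ι} (x : Tup A l) (y : Tup A k),
    (x.append y).toList = x.toList ++ y.toList
  | _, _, nil, _ => rfl
  | _, _, cons a x, y => by rw [append, toList, toList, toList_append x y, List.cons_append]

theorem exists_append : ∀ {l k : List ι} (x : Tup A (l ++ k)), ∃ y z, x = append y z
  | [], _, x => ⟨nil, x, rfl⟩
  | _ :: l, _, cons a x => by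
    obtain ⟨y, z, rfl⟩ := exists_append (l := l) x
    exact ⟨cons a y, z, rfl⟩

theorem exists_map_eq {F : ∀ i, A i → B i} (hF : ∀ i, Function.Surjective (F i)) :
    ∀ {l : List ι} (y : Tup B l), ∃ d : Tup A l, d.map F = y
  | _, nil => ⟨nil, rfl⟩
  | _, cons b y => by
    obtain ⟨a, rfl⟩ := hF _ b
    obtain ⟨d, rfl⟩ := exists_map_eq hF y
    exact ⟨cons a d, rfl⟩

theorem exists_toList_eq : ∀ L : List (Σ i, A i), ∃ (l : List ι) (x : Tup A l), x.toList = L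
  | [] => ⟨[], nil, rfl⟩
  | ⟨i, a⟩ :: L => by
    obtain ⟨l, x, rfl⟩ := exists_toList_eq L
    exact ⟨i :: l, cons a x, rfl⟩

theorem exists_fresh_point (hA : ∀ i, Infinite (A i)) {F : Set (Σ i, A i)} (hF : F.Finite)
    (i : ι) : ∃ a : A i, (⟨i, a⟩ : Σ i, A i) ∉ F := by
  have := hA i
  have h : ((fun a : A i => (⟨i, a⟩ : Σ i, A i)) ⁻¹' F).Finite :=
    hF.preimage fun a _ b _ hab => by simpa using hab
  exact h.infinite_compl.nonempty

theorem exists_fresh (hA : ∀ i, Infinite (A i)) :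
    ∀ (l : List ι) {F : Set (Σ i, A i)}, F.Finite →
    ∃ x : Tup A l, x.toList.Nodup ∧ ∀ w ∈ x.toList, w ∉ F
  | [], _, _ => ⟨nil, List.nodup_nil, by simp [toList]⟩
  | i :: l, F, hF => by
    obtain ⟨a, ha⟩ := exists_fresh_point hA hF i
    obtain ⟨x, hx, hxF⟩ := exists_fresh hA l (hF.insert ⟨i, a⟩)
    refine ⟨cons a x, ?_, ?_⟩
    · rw [toList, List.nodup_cons]
      exact ⟨fun h => hxF _ h (Set.mem_insert _ _), hx⟩
    · intro w hw
      rw [toList, List.mem_cons] at hw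
      rcases hw with rfl | hw
      · exact ha
      · exact fun h => hxF w hw (Set.mem_insert_of_mem _ h)

end Tup

/-! ### Expressions with Henkin constants -/

variable {S : Signature.{u}}

/-- The expressions of `S` enlarged by constants: for each variable `x` of sort `α` and each
enlarged formula `φ` there is a constant `wit α x φ` of sort `α`, which is to witness `∃ x, φ`.
Being a constant, `wit α x φ` has no free variables and is not affected by substitutions. -/
inductive HExpr (S : Signature.{u}) : S.Srt → Type u
  | var (α : S.VSrt) (x : S.Var α) : HExpr S α.1
  | wit (α : S.VSrt) (x : S.Var α) (φ : HExpr S .prop) : HExpr S α.1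
  | app (o : Sym S) (v : ∀ i : Fin o.rank.len, Tup S.Var (o.rank.bnd i))
      (hv : ∀ i, (v i).toList.Nodup) (a : ∀ i : Fin o.rank.len, HExpr S (o.rank.arg i)) :
      HExpr S o.rank.res

/-- The indices of the Henkin constants. -/
abbrev Wit (S : Signature.{u}) : Type u := Σ α : S.VSrt, S.Var α × HExpr S .prop

/-- The replacements for the variables in a substitution. -/
abbrev Env (S : Signature.{u}) : Type u := ∀ w : S.AVar, HExpr S w.1.1

/-- `θ` changed to take the values `d` at the points `x`. -/
noncomputable abbrev Env.over {S : Signature.{u}} (θ : Env S) {σ : List S.VSrt} (x : Tup S.Var σ)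
    (d : Tup (fun α : S.VSrt => HExpr S α.1) σ) : Env S :=
  Tup.overwrite (B := fun α : S.VSrt => HExpr S α.1) θ x d

/-- The identical substitution. -/
def Env.id (S : Signature.{u}) : Env S := fun w => .var w.1 w.2

namespace HExpr

/-- Free variables. -/
def fv : {γ : S.Srt} → HExpr S γ → Set S.AVar
  | _, var α x => {⟨α, x⟩}
  | _, wit _ _ _ => ∅
  | _, app _ v _ a => ⋃ i, fv (a i) \ {w | w ∈ (v i).toList}

/-- Bound variables. -/
def bv : {γ : S.Srt} → HExpr S γ → Set S.AVar
  | _, var _ _ => ∅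
  | _, wit _ _ _ => ∅
  | _, app _ v _ a => ⋃ i, bv (a i) ∪ {w | w ∈ (v i).toList}

/-- The Henkin constants that occur in an expression, other than inside the index of a Henkin
constant. -/
def wits : {γ : S.Srt} → HExpr S γ → Set (Wit S)
  | _, var _ _ => ∅
  | _, wit α x φ => {⟨α, x, φ⟩}
  | _, app _ _ _ a => ⋃ i, wits (a i)

/-- The size of an expression, which takes into account the indices of its Henkin constants. -/
def size : {γ : S.Srt} → HExpr S γ → ℕ
  | _, var _ _ => 0
  | _, wit _ _ φ => size φ + 1
  | _, app _ _ _ a => ∑ i, size (a i)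

/-- The variables of a sequence, as a sequence of expressions. -/
def vars {σ : List S.VSrt} (v : Tup S.Var σ) : Tup (fun α : S.VSrt => HExpr S α.1) σ :=
  v.map var

/-- Simultaneous substitution for the free occurrences of variables. -/
noncomputable def subst : {γ : S.Srt} → HExpr S γ → Env S → HExpr S γ
  | _, var α x, θ => θ ⟨α, x⟩
  | _, wit α x φ, _ => wit α x φ
  | _, app o v hv a, θ => app o v hv fun i => subst (a i) (θ.over (v i) (vars (v i)))

theorem over_vars_of_mem (θ : Env S) {σ : List S.VSrt} {v : Tup S.Var σ} {w : S.AVar}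
    (h : w ∈ v.toList) : θ.over v (vars v) w = var w.1 w.2 :=
  Tup.overwrite_map_self _ _ _ h

theorem over_of_notMem (θ : Env S) {σ : List S.VSrt} {v : Tup S.Var σ}
    (d : Tup (fun α : S.VSrt => HExpr S α.1) σ) {w : S.AVar} (h : w ∉ v.toList) :
    θ.over v d w = θ w :=
  Tup.overwrite_of_notMem _ _ _ h

theorem subst_congr : ∀ {γ : S.Srt} (e : HExpr S γ) {θ θ' : Env S}, (∀ w ∈ e.fv, θ w = θ' w) →
    e.subst θ = e.subst θ'
  | _, var α x, _, _, h => h _ rfl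
  | _, wit _ _ _, _, _, _ => rfl
  | _, app o v hv a, θ, θ', h => by
    rw [subst, subst]
    congr 1
    funext i
    refine subst_congr (a i) fun w hw => Tup.overwrite_congr _ _ _ _ fun hwv => h w ?_
    exact Set.mem_iUnion.2 ⟨i, hw, hwv⟩

theorem subst_id : ∀ {γ : S.Srt} (e : HExpr S γ), e.subst (Env.id S) = e
  | _, var _ _ => rfl
  | _, wit _ _ _ => rfl
  | _, app o v hv a => by
    rw [subst]
    congr 1
    funext i
    conv_rhs => rw [← subst_id (a i)]
    refine subst_congr (a i) fun w _ => ?_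
    by_cases h : w ∈ (v i).toList
    · exact over_vars_of_mem _ h
    · exact Tup.overwrite_of_notMem _ _ _ h

theorem subst_eq_self {γ : S.Srt} (e : HExpr S γ) {θ : Env S}
    (h : ∀ w ∈ e.fv, θ w = var w.1 w.2) : e.subst θ = e :=
  (subst_congr e h).trans (subst_id e)

theorem subst_of_closed {γ : S.Srt} {e : HExpr S γ} (h : e.fv = ∅) (θ : Env S) :
    e.subst θ = e :=
  subst_eq_self e (by simp [h])

/-- Two successive substitutions amount to one, provided that no variable brought in by the first
one gets bound. -/
theorem subst_subst : ∀ {γ : S.Srt} (e : HExpr S γ) {θ η : Env S},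
    (∀ w ∈ e.fv, θ w = var w.1 w.2 ∨ Disjoint (θ w).fv e.bv) →
    (e.subst θ).subst η = e.subst fun w => (θ w).subst η
  | _, var _ _, _, _, _ => rfl
  | _, wit _ _ _, _, _, _ => rfl
  | _, app o v hv a, θ, η, h => by
    rw [subst, subst, subst]
    congr 1
    funext i
    have hbv : (a i).bv ⊆ (app o v hv a).bv := fun w hw => Set.mem_iUnion.2 ⟨i, Or.inl hw⟩
    rw [subst_subst (a i)]
    · refine subst_congr (a i) fun w hw => ?_
      by_cases hwv : w ∈ (v i).toList
      · rw [over_vars_of_mem _ hwv, over_vars_of_mem _ hwv]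
        exact over_vars_of_mem _ hwv
      · rw [over_of_notMem _ _ hwv, over_of_notMem (fun w => (θ w).subst η) _ hwv]
        refine subst_congr _ fun t ht => over_of_notMem _ _ fun htv => ?_
        rcases h w (Set.mem_iUnion.2 ⟨i, hw, hwv⟩) with h | h
        · rw [h] at ht
          obtain rfl : t = w := ht
          exact hwv htv
        · exact Set.disjoint_left.1 h ht (Set.mem_iUnion.2 ⟨i, Or.inr htv⟩)
    · intro w hw
      by_cases hwv : w ∈ (v i).toList
      · exact Or.inl (over_vars_of_mem _ hwv)
      · rw [over_of_notMem _ _ hwv]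
        exact (h w (Set.mem_iUnion.2 ⟨i, hw, hwv⟩)).imp_right fun h => h.mono_right hbv

theorem mem_fv_subst : ∀ {γ : S.Srt} (e : HExpr S γ) {θ : Env S} {t : S.AVar},
    t ∈ (e.subst θ).fv → ∃ w ∈ e.fv, t ∈ (θ w).fv
  | _, var α x, _, _, h => ⟨_, rfl, h⟩
  | _, wit _ _ _, _, _, h => h.elim
  | _, app o v hv a, θ, t, h => by
    obtain ⟨i, h, htv⟩ := Set.mem_iUnion.1 h
    obtain ⟨w, hw, ht⟩ := mem_fv_subst (a i) h
    by_cases hwv : w ∈ (v i).toList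
    · rw [over_vars_of_mem _ hwv] at ht
      obtain rfl : t = w := ht
      exact absurd hwv htv
    · rw [over_of_notMem _ _ hwv] at ht
      exact ⟨w, Set.mem_iUnion.2 ⟨i, hw, hwv⟩, ht⟩

theorem mem_wits_subst : ∀ {γ : S.Srt} (e : HExpr S γ) {θ : Env S} {t : Wit S},
    t ∈ (e.subst θ).wits → t ∈ e.wits ∨ ∃ w, t ∈ (θ w).wits
  | _, var α x, _, _, h => Or.inr ⟨_, h⟩
  | _, wit _ _ _, _, _, h => Or.inl h
  | _, app o v hv a, θ, t, h => by
    obtain ⟨i, h⟩ := Set.mem_iUnion.1 h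
    rcases mem_wits_subst (a i) h with h | ⟨w, h⟩
    · exact Or.inl (Set.mem_iUnion.2 ⟨i, h⟩)
    · by_cases hwv : w ∈ (v i).toList
      · rw [over_vars_of_mem _ hwv] at h
        exact h.elim
      · rw [over_of_notMem _ _ hwv] at h
        exact Or.inr ⟨w, h⟩

theorem size_lt_of_mem_wits : ∀ {γ : S.Srt} (e : HExpr S γ) {w : Wit S}, w ∈ e.wits →
    w.2.2.size < e.size
  | _, wit _ _ _, _, h => by
    obtain rfl := h
    exact Nat.lt_succ_self _
  | _, app o v hv a, w, h => by
    obtain ⟨i, h⟩ := Set.mem_iUnion.1 h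
    refine (size_lt_of_mem_wits (a i) h).trans_le ?_
    rw [size]
    exact Finset.single_le_sum (f := fun i => size (a i)) (fun _ _ => Nat.zero_le _)
      (Finset.mem_univ i)

theorem finite_fv : ∀ {γ : S.Srt} (e : HExpr S γ), e.fv.Finite
  | _, var _ _ => Set.finite_singleton _
  | _, wit _ _ _ => Set.finite_empty
  | _, app _ _ _ a => Set.finite_iUnion fun i => (finite_fv (a i)).subset Set.sdiff_subset

theorem finite_bv : ∀ {γ : S.Srt} (e : HExpr S γ), e.bv.Finite
  | _, var _ _ => Set.finite_empty
  | _, wit _ _ _ => Set.finite_empty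
  | _, app _ _ _ a => Set.finite_iUnion fun i => (finite_bv (a i)).union (List.finite_toSet _)

/-! ### Formulas and substitution -/

/-- `⊤` -/
def verum : HExpr S .prop :=
  app .verum (fun _ => Tup.nil) (fun _ => List.nodup_nil) (fun i => i.elim0)

/-- `⊥` -/
def falsum : HExpr S .prop :=
  app .falsum (fun _ => Tup.nil) (fun _ => List.nodup_nil) (fun i => i.elim0)

/-- `¬φ` -/
def neg (φ : HExpr S .prop) : HExpr S .prop :=
  app .neg (fun _ => Tup.nil) (fun _ => List.nodup_nil) (fun _ => φ)

/-- `φ → ψ` -/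
def imp (φ ψ : HExpr S .prop) : HExpr S .prop :=
  app .imp (fun _ => Tup.nil) (fun _ => List.nodup_nil) ![φ, ψ]

/-- `φ ∧ ψ` -/
def and (φ ψ : HExpr S .prop) : HExpr S .prop :=
  app .and (fun _ => Tup.nil) (fun _ => List.nodup_nil) ![φ, ψ]

/-- `φ ∨ ψ` -/
def or (φ ψ : HExpr S .prop) : HExpr S .prop :=
  app .or (fun _ => Tup.nil) (fun _ => List.nodup_nil) ![φ, ψ]

/-- `φ ↔ ψ` -/
def iff (φ ψ : HExpr S .prop) : HExpr S .prop :=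
  app .iff (fun _ => Tup.nil) (fun _ => List.nodup_nil) ![φ, ψ]

/-- `∀ x, φ` -/
def all {α : S.VSrt} (x : S.Var α) (φ : HExpr S .prop) : HExpr S .prop :=
  app (.all α) (fun _ => Tup.single x) (fun _ => List.nodup_singleton _) (fun _ => φ)

/-- `∃ x, φ` -/
def ex {α : S.VSrt} (x : S.Var α) (φ : HExpr S .prop) : HExpr S .prop :=
  app (.ex α) (fun _ => Tup.single x) (fun _ => List.nodup_singleton _) (fun _ => φ)

/-- `a = b`, which is `a ↔ b` for formulas `a`, `b`. -/
def equal : {γ : S.Srt} → HExpr S γ → HExpr S γ → HExpr S .prop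
  | .prop, a, b => iff a b
  | .ind i, a, b => app (.eq i) (fun _ => Tup.nil) (fun _ => List.nodup_nil) ![a, b]

/-- `∀ z₁, …, ∀ zᵣ, φ` -/
def allSeq : {σ : List S.VSrt} → Tup S.Var σ → HExpr S .prop → HExpr S .prop
  | _, .nil, φ => φ
  | _, .cons x z, φ => all x (allSeq z φ)

/-- The substitution `e[x ← d]`. -/
noncomputable def substOne {γ : S.Srt} (e : HExpr S γ) {α : S.VSrt} (x : S.Var α)
    (d : HExpr S α.1) : HExpr S γ :=
  e.subst ((Env.id S).over (Tup.single x) (Tup.single d))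

theorem subst_app_nil {o : Sym S} {v : ∀ i : Fin o.rank.len, Tup S.Var (o.rank.bnd i)}
    (hv : ∀ i, (v i).toList.Nodup) (a : ∀ i : Fin o.rank.len, HExpr S (o.rank.arg i)) (θ : Env S)
    (h : ∀ i, (v i).toList = []) :
    (app o v hv a).subst θ = app o v hv fun i => (a i).subst θ := by
  rw [subst]
  congr 1
  funext i
  exact subst_congr _ fun w _ => over_of_notMem _ _ (by simp [h i])

theorem equal_subst {γ : S.Srt} (a b : HExpr S γ) (θ : Env S) :
    (a.equal b).subst θ = (a.subst θ).equal (b.subst θ) := by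
  cases γ <;>
  · refine (subst_app_nil _ _ _ fun _ => rfl).trans ?_
    refine congrArg _ ?_
    funext i
    match i with
    | 0 => rfl
    | 1 => rfl

theorem neg_subst (a : HExpr S .prop) (θ : Env S) : (a.neg).subst θ = (a.subst θ).neg :=
  subst_app_nil _ _ _ fun _ => rfl

theorem allSeq_subst : ∀ {σ : List S.VSrt} (z : Tup S.Var σ) (φ : HExpr S .prop) (θ : Env S),
    (allSeq z φ).subst θ = allSeq z (φ.subst (θ.over z (vars z)))
  | _, .nil, _, _ => rfl
  | _, .cons x z, φ, θ =>
    congrArg (all x) (allSeq_subst z φ (θ.over (Tup.single x) (vars (Tup.single x))))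

/-! ### Replacing the Henkin constants by variables -/

/-- The result of replacing each Henkin constant by the variable that `ρ` assigns to it. -/
def tr (ρ : ∀ w : Wit S, S.Var w.1) : {γ : S.Srt} → HExpr S γ → Expr S γ
  | _, var α x => .var α x
  | _, wit α x φ => .var α (ρ ⟨α, x, φ⟩)
  | _, app o v hv a => .app o v hv fun i => tr ρ (a i)

/-- The expressions of `S` are enlarged expressions. -/
def ofExpr : {γ : S.Srt} → Expr S γ → HExpr S γ
  | _, .var α x => var α x
  | _, .app o v hv a => app o v hv fun i => ofExpr (a i)

section tr

variable (ρ : ∀ w : Wit S, S.Var w.1)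

theorem tr_neg (φ : HExpr S .prop) : tr ρ φ.neg = (tr ρ φ).neg := rfl

theorem tr_falsum : tr ρ (falsum : HExpr S .prop) = .falsum := by
  refine congrArg _ (funext fun i => i.elim0)

theorem tr_verum : tr ρ (verum : HExpr S .prop) = .verum := by
  refine congrArg _ (funext fun i => i.elim0)

theorem tr_imp (φ ψ : HExpr S .prop) : tr ρ (φ.imp ψ) = (tr ρ φ).imp (tr ρ ψ) :=
  congrArg _ (funext fun i => match i with
    | 0 => rfl
    | 1 => rfl)

theorem tr_and (φ ψ : HExpr S .prop) : tr ρ (φ.and ψ) = (tr ρ φ).and (tr ρ ψ) :=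
  congrArg _ (funext fun i => match i with
    | 0 => rfl
    | 1 => rfl)

theorem tr_or (φ ψ : HExpr S .prop) : tr ρ (φ.or ψ) = (tr ρ φ).or (tr ρ ψ) :=
  congrArg _ (funext fun i => match i with
    | 0 => rfl
    | 1 => rfl)

theorem tr_iff (φ ψ : HExpr S .prop) : tr ρ (φ.iff ψ) = (tr ρ φ).iff (tr ρ ψ) :=
  congrArg _ (funext fun i => match i with
    | 0 => rfl
    | 1 => rfl)

theorem tr_equal : ∀ {γ : S.Srt} (a b : HExpr S γ), tr ρ (a.equal b) = (tr ρ a).equal (tr ρ b)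
  | .prop, a, b => tr_iff ρ a b
  | .ind _, _, _ => congrArg _ (funext fun i => match i with
    | 0 => rfl
    | 1 => rfl)

theorem tr_all {α : S.VSrt} (x : S.Var α) (φ : HExpr S .prop) :
    tr ρ (all x φ) = .all x (tr ρ φ) := rfl

theorem tr_ex {α : S.VSrt} (x : S.Var α) (φ : HExpr S .prop) :
    tr ρ (ex x φ) = .ex x (tr ρ φ) := rfl

theorem tr_allSeq : ∀ {σ : List S.VSrt} (z : Tup S.Var σ) (φ : HExpr S .prop),
    tr ρ (allSeq z φ) = .allSeq z (tr ρ φ)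
  | _, .nil, _ => rfl
  | _, .cons x z, φ => by rw [allSeq, tr_all, tr_allSeq z, Expr.allSeq]

theorem tr_vars {σ : List S.VSrt} (z : Tup S.Var σ) :
    (vars z).map (fun _ => tr ρ) = Expr.vars z :=
  Tup.map_map _ _ _

theorem tr_ofExpr : ∀ {γ : S.Srt} (e : Expr S γ), tr ρ (ofExpr e) = e
  | _, .var _ _ => rfl
  | _, .app o v hv a => by
    rw [ofExpr, tr]
    exact congrArg _ (funext fun i => tr_ofExpr (a i))

theorem tr_congr {ρ ρ' : ∀ w : Wit S, S.Var w.1} : ∀ {γ : S.Srt} (e : HExpr S γ),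
    (∀ w ∈ e.wits, ρ w = ρ' w) → tr ρ e = tr ρ' e
  | _, var _ _, _ => rfl
  | _, wit _ _ _, h => congrArg _ (h _ rfl)
  | _, app _ _ _ a, h =>
    congrArg _ (funext fun i => tr_congr (a i) fun w hw => h w (Set.mem_iUnion.2 ⟨i, hw⟩))

theorem bv_tr : ∀ {γ : S.Srt} (e : HExpr S γ), (tr ρ e).bv = e.bv
  | _, var _ _ => rfl
  | _, wit _ _ _ => rfl
  | _, app o v hv a => by simp only [tr, Expr.bv, bv, bv_tr]

theorem mem_fv_tr : ∀ {γ : S.Srt} (e : HExpr S γ) {t : S.AVar}, t ∈ (tr ρ e).fv →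
    t ∈ e.fv ∨ ∃ w : Wit S, t = ⟨w.1, ρ w⟩
  | _, var _ _, _, h => Or.inl h
  | _, wit α x φ, _, h => Or.inr ⟨⟨α, x, φ⟩, h⟩
  | _, app o v hv a, t, h => by
    obtain ⟨i, h, htv⟩ := Set.mem_iUnion.1 h
    exact (mem_fv_tr (a i) h).imp_left fun h => Set.mem_iUnion.2 ⟨i, h, htv⟩

/-- Replacing the Henkin constants by variables commutes with substitution as long as the
substitution leaves these variables alone. -/
theorem tr_subst : ∀ {γ : S.Srt} (e : HExpr S γ) {θ : Env S},
    (∀ w : Wit S, tr ρ (θ ⟨w.1, ρ w⟩) = .var w.1 (ρ w)) →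
    tr ρ (e.subst θ) = (tr ρ e).subst fun w => tr ρ (θ w)
  | _, var _ _, _, _ => rfl
  | _, wit α x φ, _, h => (h ⟨α, x, φ⟩).symm
  | _, app o v hv a, θ, h => by
    rw [subst, tr, tr, Expr.subst]
    refine congrArg _ (funext fun i => ?_)
    rw [tr_subst (a i)]
    · congr 1
      funext w
      rw [← tr_vars ρ]
      exact Tup.apply_overwrite (B := fun α : S.VSrt => HExpr S α.1)
        (C := fun α : S.VSrt => Expr S α.1) (fun _ => tr ρ) (v i) θ (vars (v i)) w
    · intro w
      by_cases hw : ⟨w.1, ρ w⟩ ∈ (v i).toList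
      · rw [over_vars_of_mem _ hw]; rfl
      · rw [over_of_notMem _ _ hw]; exact h w

theorem tr_substSeq {γ : S.Srt} (e : HExpr S γ) {σ : List S.VSrt} (x : Tup S.Var σ)
    (d : Tup (fun α : S.VSrt => HExpr S α.1) σ) (h : ∀ w : Wit S, ⟨w.1, ρ w⟩ ∉ x.toList) :
    tr ρ (e.subst ((Env.id S).over x d)) = (tr ρ e).substSeq x (d.map fun _ => tr ρ) := by
  rw [tr_subst ρ e fun w => by rw [over_of_notMem _ _ (h w)]; rfl]
  refine congrArg _ (funext fun w => ?_)
  exact Tup.apply_overwrite (B := fun α : S.VSrt => HExpr S α.1)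
    (C := fun α : S.VSrt => Expr S α.1) (fun _ => tr ρ) x (Env.id S) d w

theorem tr_substOne {γ : S.Srt} (e : HExpr S γ) {α : S.VSrt} (x : S.Var α)
    (d : HExpr S α.1) (h : ∀ w : Wit S, (⟨w.1, ρ w⟩ : S.AVar) ≠ ⟨α, x⟩) :
    tr ρ (e.substOne x d) = (tr ρ e).substOne x (tr ρ d) :=
  tr_substSeq ρ e _ _ fun w hw => h w (by simpa [Tup.toList] using hw)

end tr

theorem fv_ofExpr : ∀ {γ : S.Srt} (e : Expr S γ), (ofExpr e).fv = e.fv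
  | _, .var _ _ => rfl
  | _, .app o v hv a => by simp only [ofExpr, Expr.fv, fv, fv_ofExpr]

theorem bv_ofExpr : ∀ {γ : S.Srt} (e : Expr S γ), (ofExpr e).bv = e.bv
  | _, .var _ _ => rfl
  | _, .app o v hv a => by simp only [ofExpr, Expr.bv, bv, bv_ofExpr]

theorem wits_ofExpr : ∀ {γ : S.Srt} (e : Expr S γ), (ofExpr e).wits = ∅
  | _, .var _ _ => rfl
  | _, .app o v hv a => by simp only [ofExpr, wits, wits_ofExpr, Set.iUnion_empty]

theorem map_ofExpr_vars {σ : List S.VSrt} (z : Tup S.Var σ) :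
    (Expr.vars z).map (fun _ => ofExpr) = vars z := by
  rw [Expr.vars, Tup.map_map]
  rfl

theorem ofExpr_subst : ∀ {γ : S.Srt} (e : Expr S γ) (θ : ∀ w : S.AVar, Expr S w.1.1),
    ofExpr (e.subst θ) = (ofExpr e).subst fun w => ofExpr (θ w)
  | _, .var _ _, _ => rfl
  | _, .app o v hv a, θ => by
    rw [Expr.subst, ofExpr, ofExpr, subst]
    refine congrArg _ (funext fun i => ?_)
    rw [ofExpr_subst (a i)]
    refine congrArg _ (funext fun w => ?_)
    rw [← map_ofExpr_vars]
    exact Tup.apply_overwrite (B := fun α : S.VSrt => Expr S α.1)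
      (C := fun α : S.VSrt => HExpr S α.1) (fun _ => ofExpr) (v i) θ (Expr.vars (v i)) w

theorem ofExpr_injective {γ : S.Srt} : Function.Injective (ofExpr (S := S) (γ := γ)) := by
  have hV : ∀ α, Nonempty (S.Var α) := fun α => @Infinite.nonempty _ (S.var_infinite α)
  exact Function.LeftInverse.injective (g := tr fun w => (hV w.1).some) (tr_ofExpr _)

end HExpr

namespace Expr

theorem finite_fv {γ : S.Srt} (e : Expr S γ) : e.fv.Finite :=
  HExpr.fv_ofExpr e ▸ (HExpr.ofExpr e).finite_fv

theorem finite_bv {γ : S.Srt} (e : Expr S γ) : e.bv.Finite :=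
  HExpr.bv_ofExpr e ▸ (HExpr.ofExpr e).finite_bv

theorem subst_congr {γ : S.Srt} (e : Expr S γ) {θ θ' : ∀ w : S.AVar, Expr S w.1.1}
    (h : ∀ w ∈ e.fv, θ w = θ' w) : e.subst θ = e.subst θ' := by
  refine HExpr.ofExpr_injective ?_
  rw [HExpr.ofExpr_subst, HExpr.ofExpr_subst]
  exact HExpr.subst_congr _ fun w hw => congrArg _ (h w (HExpr.fv_ofExpr e ▸ hw))

theorem subst_eq_self {γ : S.Srt} (e : Expr S γ) {θ : ∀ w : S.AVar, Expr S w.1.1}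
    (h : ∀ w ∈ e.fv, θ w = var w.1 w.2) : e.subst θ = e := by
  refine HExpr.ofExpr_injective ?_
  rw [HExpr.ofExpr_subst]
  exact HExpr.subst_eq_self _ fun w hw => by rw [h w (HExpr.fv_ofExpr e ▸ hw)]; rfl

theorem subst_subst {γ : S.Srt} (e : Expr S γ) {θ η : ∀ w : S.AVar, Expr S w.1.1}
    (h : ∀ w ∈ e.fv, θ w = var w.1 w.2 ∨ Disjoint (θ w).fv e.bv) :
    (e.subst θ).subst η = e.subst fun w => (θ w).subst η := by
  refine HExpr.ofExpr_injective ?_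
  rw [HExpr.ofExpr_subst, HExpr.ofExpr_subst, HExpr.ofExpr_subst, HExpr.subst_subst]
  · simp only [HExpr.ofExpr_subst]
  · intro w hw
    rw [HExpr.fv_ofExpr, HExpr.bv_ofExpr]
    exact (h w (HExpr.fv_ofExpr e ▸ hw)).imp_left fun h => by rw [h]; rfl

theorem substitutable_of_disjoint {δ : S.Srt} (d : Expr S δ) (x : S.AVar) :
    ∀ {γ : S.Srt} (e : Expr S γ), Disjoint d.fv e.bv → d.Substitutable x e
  | _, var _ _, _ => trivial
  | _, app o v hv a, h => fun i => by
    refine Or.inr ⟨substitutable_of_disjoint d x (a i) (h.mono_right fun w hw => ?_), ?_⟩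
    · exact Set.mem_iUnion.2 ⟨i, Or.inl hw⟩
    · exact Set.disjoint_iff_inter_eq_empty.1
        (h.mono_right fun w hw => Set.mem_iUnion.2 ⟨i, Or.inr hw⟩)

theorem substitutable_self {α : S.VSrt} (x : S.Var α) :
    ∀ {γ : S.Srt} (e : Expr S γ), (var α x).Substitutable ⟨α, x⟩ e
  | _, var _ _ => trivial
  | _, app o v hv a => fun i => by
    by_cases h : ⟨α, x⟩ ∈ (v i).toList
    · exact Or.inl h
    · exact Or.inr ⟨substitutable_self x (a i), by simpa [fv] using h⟩

theorem substOne_self {γ : S.Srt} (e : Expr S γ) {α : S.VSrt} (x : S.Var α) :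
    e.substOne x (var α x) = e := by
  refine subst_eq_self e fun w _ => ?_
  by_cases hw : w = ⟨α, x⟩
  · subst hw; exact Tup.overwrite_single_self _ _ _
  · exact Tup.overwrite_single_of_ne _ _ _ hw

end Expr

variable {T : Set (Formula S)}

/-! ### Derivations in the calculus -/

namespace Derivable

theorem of_taut {φ ψ : Formula S} (h : Derivable T φ)
    (hV : ∀ V, IsValuation V → V φ → V ψ) : Derivable T ψ :=
  mp _ _ h (taut _ fun V h => (h.imp _ _).2 (hV V h))

theorem of_taut₂ {φ ψ χ : Formula S} (h₁ : Derivable T φ) (h₂ : Derivable T ψ)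
    (hV : ∀ V, IsValuation V → V φ → V ψ → V χ) : Derivable T χ :=
  mp _ _ h₂ (h₁.of_taut fun V h h' => (h.imp _ _).2 (hV V h h'))

theorem of_allSeq : ∀ {σ : List S.VSrt} {z : Tup S.Var σ} {φ : Formula S},
    Derivable T (.allSeq z φ) → Derivable T φ
  | _, .nil, _, h => h
  | _, .cons x z, φ, h => by
    have h' := mp _ _ h (all_elim x (.var _ x) _ (Expr.substitutable_self x (.allSeq z φ)))
    rw [Expr.substOne_self] at h'
    exact of_allSeq h'

theorem allSeq : ∀ {σ : List S.VSrt} (z : Tup S.Var σ) {φ : Formula S},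
    Derivable T φ → Derivable T (.allSeq z φ)
  | _, .nil, _, h => h
  | _, .cons x z, _, h => gen x _ (allSeq z h)

theorem not_ex_not_imp_all {α : S.VSrt} (x : S.Var α) (φ : Formula S) :
    Derivable T ((Expr.ex x φ.neg).neg.imp (.all x φ)) := by
  have h := ex_intro (T := T) x (.var _ x) _ (Expr.substitutable_self x φ.neg)
  rw [Expr.substOne_self] at h
  have h' : Derivable T ((Expr.ex x φ.neg).neg.imp φ) := h.of_taut fun V hV => by
    simp only [hV.imp, hV.neg]; tauto
  refine mp _ _ (gen x _ h') (all_imp x _ _ ?_)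
  simp [Expr.neg, Expr.ex, Expr.fv, Tup.toList]

/-- Renaming of a variable bound by a quantifier. The `x` in the place of `y` may get bound in
`φ[x ← y]`, so that this does not follow from the quantifier axioms alone, but it is an instance of
the congruence axiom. -/
theorem ex_rename {α : S.VSrt} (x y : S.Var α) (φ : Formula S) (hfv : ⟨α, y⟩ ∉ φ.fv)
    (hbv : ⟨α, y⟩ ∉ φ.bv) :
    Derivable T ((Expr.ex x φ).iff (.ex y (φ.substOne x (.var α y)))) := by
  obtain ⟨z, hz⟩ := Tup.exists_fresh_point S.var_infinite
    ((φ.finite_fv.union φ.finite_bv).union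
      ((φ.substOne x (.var α y)).finite_fv.union (φ.substOne x (.var α y)).finite_bv)) α
  simp only [Set.mem_union, not_or] at hz
  have h := eq_congr (T := T) (.ex α) (fun _ => Tup.single x) (fun _ => Tup.single y)
    (fun _ => List.nodup_singleton _) (fun _ => List.nodup_singleton _) (fun _ => φ)
    (fun _ => φ.substOne x (.var α y)) 0 (fun j hj => absurd (Subsingleton.elim j 0) hj)
    (Tup.single z) (List.nodup_singleton _)
    (by simpa [Tup.toList] using ⟨hz.1.1, hz.2.1⟩) (by simpa [Tup.toList] using ⟨hz.1.2, hz.2.2⟩)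
  refine mp _ _ (allSeq (Tup.single z) ?_) h
  have : (φ.substOne x (.var α y)).substSeq (Tup.single y) (Tup.single (.var α z)) =
      φ.substSeq (Tup.single x) (Tup.single (.var α z)) := by
    refine (Expr.subst_subst φ fun w _ => ?_).trans (Expr.subst_congr φ fun w hw => ?_)
    · by_cases hwx : w = ⟨α, x⟩
      · subst hwx
        rw [Tup.overwrite_single_self]
        exact Or.inr (Set.disjoint_singleton_left.2 hbv)
      · exact Or.inl (Tup.overwrite_single_of_ne _ _ _ hwx)
    · by_cases hwx : w = ⟨α, x⟩
      · subst hwx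
        rw [Tup.overwrite_single_self, Tup.overwrite_single_self]
        exact Tup.overwrite_single_self _ _ _
      · rw [Tup.overwrite_single_of_ne _ _ _ hwx, Tup.overwrite_single_of_ne _ _ _ hwx]
        refine Tup.overwrite_single_of_ne _ _ _ ?_
        exact fun hwy => hfv (hwy ▸ hw)
  change Derivable T ((φ.substSeq (Tup.single x) (Tup.single (.var α z))).equal
    ((φ.substOne x (.var α y)).substSeq (Tup.single y) (Tup.single (.var α z))))
  rw [this]
  exact eq_refl _

/-- An assumption `∃ x, φ → φ[x ← y]` with a fresh variable `y` can be dropped. -/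
theorem of_witness_imp {α : S.VSrt} {x y : S.Var α} {φ χ : Formula S} (hfv : ⟨α, y⟩ ∉ φ.fv)
    (hbv : ⟨α, y⟩ ∉ φ.bv) (hχ : ⟨α, y⟩ ∉ χ.fv)
    (h : Derivable T (((Expr.ex x φ).imp (φ.substOne x (.var α y))).imp χ)) : Derivable T χ := by
  have h₁ : Derivable T ((φ.substOne x (.var α y)).imp χ) := h.of_taut fun V hV => by
    simp only [hV.imp]; tauto
  have h₂ := mp _ _ (gen y _ h₁) (ex_imp y _ _ hχ)
  have h₃ : Derivable T ((Expr.ex x φ).imp χ) := h₂.of_taut₂ (ex_rename x y φ hfv hbv)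
    fun V hV => by simp only [hV.imp, hV.iff]; tauto
  exact h₃.of_taut₂ h fun V hV => by simp only [hV.imp]; tauto

end Derivable

/-! ### Derivability of enlarged formulas -/

/-- An enlarged formula is derivable from `T` if, with the exception of finitely many variables,
all replacements of its Henkin constants by variables lead to formulas derivable from `T`. -/
def HDerivable (T : Set (Formula S)) (φ : HExpr S .prop) : Prop :=
  ∃ F : Set S.AVar, F.Finite ∧ ∀ ρ : ∀ w : Wit S, S.Var w.1, (∀ w, ⟨w.1, ρ w⟩ ∉ F) →
    Derivable T (φ.tr ρ)

/-- A truth assignment to the enlarged formulas that respects the propositional connectives. -/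
structure IsHValuation (V : HExpr S .prop → Prop) : Prop where
  verum : V .verum
  falsum : ¬ V .falsum
  neg : ∀ φ, V φ.neg ↔ ¬ V φ
  imp : ∀ φ ψ, V (φ.imp ψ) ↔ (V φ → V ψ)
  and : ∀ φ ψ, V (φ.and ψ) ↔ (V φ ∧ V ψ)
  or : ∀ φ ψ, V (φ.or ψ) ↔ (V φ ∨ V ψ)
  iff : ∀ φ ψ, V (φ.iff ψ) ↔ (V φ ↔ V ψ)

theorem IsValuation.comp_tr {V : Formula S → Prop} (hV : IsValuation V)
    (ρ : ∀ w : Wit S, S.Var w.1) : IsHValuation fun φ => V (φ.tr ρ) where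
  verum := by rw [HExpr.tr_verum]; exact hV.verum
  falsum := by rw [HExpr.tr_falsum]; exact hV.falsum
  neg φ := by rw [HExpr.tr_neg]; exact hV.neg _
  imp φ ψ := by rw [HExpr.tr_imp]; exact hV.imp _ _
  and φ ψ := by rw [HExpr.tr_and]; exact hV.and _ _
  or φ ψ := by rw [HExpr.tr_or]; exact hV.or _ _
  iff φ ψ := by rw [HExpr.tr_iff]; exact hV.iff _ _

/-- `∃ x, φ → φ[x ← c]` for the Henkin constant `c` with the given index. -/
noncomputable def henkin (w : Wit S) : HExpr S .prop :=
  (HExpr.ex w.2.1 w.2.2).imp (w.2.2.substOne w.2.1 (.wit w.1 w.2.1 w.2.2))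

namespace HDerivable

open HExpr

theorem of_forall {φ : HExpr S .prop} (h : ∀ ρ, Derivable T (φ.tr ρ)) : HDerivable T φ :=
  ⟨∅, Set.finite_empty, fun ρ _ => h ρ⟩

theorem of_taut {φ ψ : HExpr S .prop} (h : HDerivable T φ)
    (hV : ∀ V, IsHValuation V → V φ → V ψ) : HDerivable T ψ := by
  obtain ⟨F, hF, h⟩ := h
  exact ⟨F, hF, fun ρ hρ => (h ρ hρ).of_taut fun V hV' => hV _ (hV'.comp_tr ρ)⟩

theorem of_taut₂ {φ ψ χ : HExpr S .prop} (h₁ : HDerivable T φ) (h₂ : HDerivable T ψ)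
    (hV : ∀ V, IsHValuation V → V φ → V ψ → V χ) : HDerivable T χ := by
  obtain ⟨F, hF, h₁⟩ := h₁
  obtain ⟨G, hG, h₂⟩ := h₂
  refine ⟨F ∪ G, hF.union hG, fun ρ hρ => (h₁ ρ ?_).of_taut₂ (h₂ ρ ?_) fun V hV' =>
    hV _ (hV'.comp_tr ρ)⟩
  · exact fun w hw => hρ w (Or.inl hw)
  · exact fun w hw => hρ w (Or.inr hw)

theorem tautology {φ : HExpr S .prop} (hV : ∀ V, IsHValuation V → V φ) : HDerivable T φ :=
  of_forall fun ρ => .taut _ fun _ h => hV _ (h.comp_tr ρ)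

theorem gen {α : S.VSrt} (x : S.Var α) {φ : HExpr S .prop} (h : HDerivable T φ) :
    HDerivable T (.all x φ) := by
  obtain ⟨F, hF, h⟩ := h
  exact ⟨F, hF, fun ρ hρ => .gen x _ (h ρ hρ)⟩

theorem disjoint_tr {γ δ : S.Srt} {d : HExpr S δ} (hd : d.fv = ∅) (e : HExpr S γ)
    {ρ : ∀ w : Wit S, S.Var w.1} (hρ : ∀ w, ⟨w.1, ρ w⟩ ∉ e.bv) :
    Disjoint (d.tr ρ).fv (e.tr ρ).bv := by
  rw [bv_tr, Set.disjoint_left]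
  intro t ht
  rcases mem_fv_tr ρ d ht with h | ⟨w, rfl⟩
  · simp [hd] at h
  · exact hρ w

theorem all_elim {α : S.VSrt} (x : S.Var α) {d : HExpr S α.1} (hd : d.fv = ∅)
    (φ : HExpr S .prop) : HDerivable T ((all x φ).imp (φ.substOne x d)) := by
  refine ⟨insert ⟨α, x⟩ φ.bv, φ.finite_bv.insert _, fun ρ hρ => ?_⟩
  rw [tr_imp, tr_all, tr_substOne ρ _ _ _ fun w hw => hρ w (Or.inl hw)]
  exact .all_elim _ _ _ (Expr.substitutable_of_disjoint _ _ _
    (disjoint_tr hd φ fun w hw => hρ w (Or.inr hw)))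

theorem ex_intro {α : S.VSrt} (x : S.Var α) {d : HExpr S α.1} (hd : d.fv = ∅)
    (φ : HExpr S .prop) : HDerivable T ((φ.substOne x d).imp (ex x φ)) := by
  refine ⟨insert ⟨α, x⟩ φ.bv, φ.finite_bv.insert _, fun ρ hρ => ?_⟩
  rw [tr_imp, tr_ex, tr_substOne ρ _ _ _ fun w hw => hρ w (Or.inl hw)]
  exact .ex_intro _ _ _ (Expr.substitutable_of_disjoint _ _ _
    (disjoint_tr hd φ fun w hw => hρ w (Or.inr hw)))

theorem not_ex_not_imp_all {α : S.VSrt} (x : S.Var α) (φ : HExpr S .prop) :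
    HDerivable T ((ex x φ.neg).neg.imp (all x φ)) :=
  of_forall fun ρ => by
    rw [tr_imp, tr_neg, tr_ex, tr_neg, tr_all]; exact .not_ex_not_imp_all x _

theorem eq_refl {γ : S.Srt} (a : HExpr S γ) : HDerivable T (a.equal a) :=
  of_forall fun ρ => by rw [tr_equal]; exact .eq_refl _

theorem eq_congr (o : Sym S) (v w : ∀ i : Fin o.rank.len, Tup S.Var (o.rank.bnd i))
    (hv : ∀ i, (v i).toList.Nodup) (hw : ∀ i, (w i).toList.Nodup)
    (a b : ∀ i : Fin o.rank.len, HExpr S (o.rank.arg i)) (i : Fin o.rank.len)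
    (hother : ∀ j, j ≠ i → v j = w j ∧ a j = b j)
    (z : Tup S.Var (o.rank.bnd i)) (hz : z.toList.Nodup)
    (hfree : ∀ t ∈ z.toList, t ∉ (a i).fv ∪ (b i).fv)
    (hbound : ∀ t ∈ z.toList, t ∉ (a i).bv ∪ (b i).bv) :
    HDerivable T ((allSeq z (((a i).subst ((Env.id S).over (v i) (vars z))).equal
      ((b i).subst ((Env.id S).over (w i) (vars z))))).imp
      ((app o v hv a).equal (app o w hw b))) := by
  refine ⟨{t | t ∈ (v i).toList} ∪ {t | t ∈ (w i).toList} ∪ {t | t ∈ z.toList},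
    ((List.finite_toSet _).union (List.finite_toSet _)).union (List.finite_toSet _),
    fun ρ hρ => ?_⟩
  rw [tr_imp, tr_allSeq, tr_equal, tr_equal,
    tr_substSeq ρ _ _ _ fun t ht => hρ t (Or.inl (Or.inl ht)),
    tr_substSeq ρ _ _ _ fun t ht => hρ t (Or.inl (Or.inr ht)), tr_vars]
  have hfv {γ : S.Srt} (e : HExpr S γ) {t : S.AVar} (ht : t ∈ z.toList) (h : t ∈ (e.tr ρ).fv) :
      t ∈ e.fv := by
    rcases mem_fv_tr ρ e h with h | ⟨w, rfl⟩
    · exact h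
    · exact absurd (Or.inr ht) (hρ w)
  refine .eq_congr o v w hv hw (fun i => (a i).tr ρ) (fun i => (b i).tr ρ) i
    (fun j hj => ⟨(hother j hj).1, congrArg _ (hother j hj).2⟩) z hz
    (fun t ht h => hfree t ht (h.imp (hfv _ ht) (hfv _ ht)))
    (fun t ht h => hbound t ht ?_)
  rwa [bv_tr, bv_tr] at h

/-- A Henkin axiom can be dropped if its constant occurs nowhere else. -/
theorem of_henkin_imp {w : Wit S} {χ : HExpr S .prop} (hχ : w ∉ χ.wits)
    (h : HDerivable T ((henkin w).imp χ)) : HDerivable T χ := by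
  classical
  obtain ⟨F, hF, h⟩ := h
  have hw : w ∉ w.2.2.wits := fun h => lt_irrefl _ (size_lt_of_mem_wits _ h)
  refine ⟨insert ⟨w.1, w.2.1⟩ F, hF.insert _, fun ρ hρ => ?_⟩
  -- Replace the constant with index `w` by a variable `y` which is new with respect to `ρ`.
  obtain ⟨y, hy⟩ := Tup.exists_fresh_point S.var_infinite
    (((hF.insert ⟨w.1, w.2.1⟩).union (w.2.2.tr ρ).finite_fv).union
      ((w.2.2.tr ρ).finite_bv.union (χ.tr ρ).finite_fv)) w.1
  simp only [Set.mem_union, not_or] at hy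
  obtain ⟨⟨hyF, hyfv⟩, hybv, hyχ⟩ := hy
  let ρ' := Function.update ρ w y
  have hρ' : ∀ t : Wit S, (⟨t.1, ρ' t⟩ : S.AVar) ∉ insert (⟨w.1, w.2.1⟩ : S.AVar) F := by
    intro t
    by_cases ht : t = w
    · subst ht; simpa [ρ'] using hyF
    · simpa [ρ', ht] using hρ t
  have htr {γ : S.Srt} (e : HExpr S γ) (he : w ∉ e.wits) : e.tr ρ' = e.tr ρ := by
    refine tr_congr e fun t ht => Function.update_of_ne ?_ _ _
    rintro rfl
    exact he ht
  have h' := h ρ' fun t ht => hρ' t (Or.inr ht)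
  rw [tr_imp, henkin, tr_imp, tr_ex, tr_substOne ρ' _ _ _ fun t ht => hρ' t (Or.inl ht), htr _ hw,
    htr _ hχ, tr] at h'
  have hy' : ρ' ⟨w.1, w.2.1, w.2.2⟩ = y := Function.update_self _ _ _
  rw [hy'] at h'
  exact .of_witness_imp hyfv hybv hyχ h'

theorem mem_wits_henkin {w t : Wit S} (h : t ∈ (henkin w).wits) : t = w ∨ t ∈ w.2.2.wits := by
  obtain ⟨i, h⟩ := Set.mem_iUnion.1 h
  match i with
  | 0 =>
    obtain ⟨_, h⟩ := Set.mem_iUnion.1 h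
    exact Or.inr h
  | 1 =>
    rcases mem_wits_subst _ h with h | ⟨s, h⟩
    · exact Or.inr h
    · by_cases hs : s = ⟨w.1, w.2.1⟩
      · subst hs
        rw [Env.over, Tup.overwrite_single_self] at h
        exact Or.inl h
      · rw [Env.over, Tup.overwrite_single_of_ne _ _ _ hs] at h
        exact h.elim

theorem imp_foldr_iff {V : HExpr S .prop → Prop} (hV : IsHValuation V) (χ : HExpr S .prop) :
    ∀ L : List (HExpr S .prop), V (L.foldr imp χ) ↔ ((∀ φ ∈ L, V φ) → V χ)
  | [] => by simp
  | φ :: L => by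
    rw [List.foldr_cons, hV.imp, imp_foldr_iff hV χ L]
    simp

theorem wits_foldr_imp {t : Wit S} {χ : HExpr S .prop} (hχ : t ∉ χ.wits) :
    ∀ L : List (HExpr S .prop), (∀ φ ∈ L, t ∉ φ.wits) → t ∉ (L.foldr imp χ).wits
  | [], _ => hχ
  | φ :: L, h => by
    intro ht
    obtain ⟨i, ht⟩ := Set.mem_iUnion.1 ht
    match i with
    | 0 => exact h φ (by simp) ht
    | 1 => exact wits_foldr_imp hχ L (fun ψ hψ => h ψ (by simp [hψ])) ht

/-- Finitely many Henkin axioms can be dropped, if their constants do not occur in the conclusion: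
the axiom whose index is largest goes first, since its constant does not occur in the others. -/
theorem of_foldr_henkin {χ : HExpr S .prop} (hχ : χ.wits = ∅) (K : Finset (Wit S))
    (h : HDerivable T ((K.toList.map henkin).foldr imp χ)) : HDerivable T χ := by
  classical
  induction K using Finset.induction_on_max_value (fun w : Wit S => w.2.2.size) with
  | empty => simpa using h
  | insert w K hw hmax ih =>
    refine ih (of_henkin_imp (w := w) ?_ (h.of_taut fun V hV hL => ?_))
    · refine wits_foldr_imp (by simp [hχ]) _ fun φ hφ hwφ => ?_
      obtain ⟨t, ht, rfl⟩ := List.mem_map.1 hφ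
      rw [Finset.mem_toList] at ht
      rcases mem_wits_henkin hwφ with rfl | h
      · exact hw ht
      · exact (size_lt_of_mem_wits _ h).not_ge (hmax t ht)
    · rw [imp_foldr_iff hV] at hL
      rw [hV.imp, imp_foldr_iff hV]
      intro h₁ h₂
      refine hL fun φ hφ => ?_
      obtain ⟨t, ht, rfl⟩ := List.mem_map.1 hφ
      rw [Finset.mem_toList, Finset.mem_insert] at ht
      rcases ht with rfl | ht
      · exact h₁
      · exact h₂ _ (List.mem_map.2 ⟨t, Finset.mem_toList.2 ht, rfl⟩)

end HDerivable

/-! ### Maximal consistent sets of enlarged formulas -/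

open HExpr HDerivable

/-- A set of enlarged formulas is consistent with `T` if no contradiction is derivable from `T` and
finitely many of its members, used as assumptions that are not subject to generalization. -/
def Consistent (T : Set (Formula S)) (Γ : Set (HExpr S .prop)) : Prop :=
  ∀ L : List (HExpr S .prop), (∀ φ ∈ L, φ ∈ Γ) → ¬ HDerivable T (L.foldr imp falsum)

theorem isOfFiniteCharacter_consistent (T : Set (Formula S)) :
    Order.IsOfFiniteCharacter {Γ | Consistent T Γ} := fun _ =>
  ⟨fun h _ hy _ L hL => h L fun φ hφ => hy (hL φ hφ),
    fun h L hL => h {φ | φ ∈ L} hL (List.finite_toSet L) L fun _ hφ => hφ⟩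

theorem consistent_henkin {χ : HExpr S .prop} (hχ : χ.wits = ∅) (h : ¬ HDerivable T χ) :
    Consistent T (insert χ.neg (Set.range henkin)) := by
  classical
  intro L hL hd
  obtain ⟨K, hK⟩ : ∃ K : Finset (Wit S), ∀ φ ∈ L, φ = χ.neg ∨ ∃ w ∈ K, henkin w = φ := by
    clear hd
    induction L with
    | nil => exact ⟨∅, by simp⟩
    | cons φ L ih =>
      obtain ⟨K, hK⟩ := ih fun ψ hψ => hL ψ (List.mem_cons_of_mem _ hψ)
      rcases hL φ List.mem_cons_self with hφ | ⟨w, hw⟩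
      · refine ⟨K, fun ψ hψ => ?_⟩
        rcases List.mem_cons.1 hψ with rfl | hψ
        exacts [Or.inl hφ, hK ψ hψ]
      · refine ⟨insert w K, fun ψ hψ => ?_⟩
        rcases List.mem_cons.1 hψ with rfl | hψ
        · exact Or.inr ⟨w, Finset.mem_insert_self _ _, hw⟩
        · exact (hK ψ hψ).imp_right fun ⟨t, ht, h⟩ => ⟨t, Finset.mem_insert_of_mem ht, h⟩
  refine h (of_foldr_henkin hχ K (hd.of_taut fun V hV hVL => ?_))
  rw [imp_foldr_iff hV] at hVL ⊢
  intro hVK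
  by_contra hVχ
  refine hV.falsum (hVL fun φ hφ => ?_)
  rcases hK φ hφ with rfl | ⟨w, hw, rfl⟩
  · exact (hV.neg _).2 hVχ
  · exact hVK _ (List.mem_map.2 ⟨w, Finset.mem_toList.2 hw, rfl⟩)

section Maximal

variable {Γ : Set (HExpr S .prop)}

theorem mem_of_derivable (hΓ : Maximal (· ∈ {Γ | Consistent T Γ}) Γ)
    {L : List (HExpr S .prop)} (hL : ∀ ψ ∈ L, ψ ∈ Γ) {φ : HExpr S .prop}
    (h : HDerivable T (L.foldr imp φ)) : φ ∈ Γ := by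
  classical
  by_contra hφ
  have hins : ¬ Consistent T (insert φ Γ) := fun hc =>
    hφ (hΓ.2 hc (Set.subset_insert _ _) (Set.mem_insert _ _))
  simp only [Consistent, not_forall, not_not] at hins
  obtain ⟨L', hL', h'⟩ := hins
  refine hΓ.1 (L ++ L'.filter (· ≠ φ)) (fun ψ hψ => ?_) (h.of_taut₂ h' fun V hV => ?_)
  · rcases List.mem_append.1 hψ with hψ | hψ
    · exact hL ψ hψ
    · rw [List.mem_filter] at hψ
      exact (hL' ψ hψ.1).resolve_left (by simpa using hψ.2)
  · rw [imp_foldr_iff hV, imp_foldr_iff hV, imp_foldr_iff hV]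
    intro h₁ h₂ h₃
    refine h₂ fun ψ hψ => ?_
    by_cases hψφ : ψ = φ
    · rw [hψφ]
      exact h₁ fun ψ hψ => h₃ ψ (List.mem_append_left _ hψ)
    · exact h₃ ψ (List.mem_append_right _ (List.mem_filter.2 ⟨hψ, by simpa using hψφ⟩))

theorem mem_of_taut (hΓ : Maximal (· ∈ {Γ | Consistent T Γ}) Γ)
    (L : List (HExpr S .prop)) (hL : ∀ ψ ∈ L, ψ ∈ Γ) {φ : HExpr S .prop}
    (h : ∀ V, IsHValuation V → (∀ ψ ∈ L, V ψ) → V φ) : φ ∈ Γ :=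
  mem_of_derivable hΓ hL (.tautology fun V hV => (imp_foldr_iff hV _ _).2 (h V hV))

theorem neg_mem_iff (hΓ : Maximal (· ∈ {Γ | Consistent T Γ}) Γ) (φ : HExpr S .prop) :
    φ.neg ∈ Γ ↔ φ ∉ Γ := by
  classical
  constructor
  · intro h h'
    refine hΓ.1 [φ, φ.neg] (by simp [h, h']) (.tautology fun V hV => ?_)
    simp only [imp_foldr_iff hV, List.forall_mem_cons, hV.neg]
    tauto
  · intro h
    have hins : ¬ Consistent T (insert φ Γ) := fun hc =>
      h (hΓ.2 hc (Set.subset_insert _ _) (Set.mem_insert _ _))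
    simp only [Consistent, not_forall, not_not] at hins
    obtain ⟨L, hL, h'⟩ := hins
    refine mem_of_derivable hΓ (L := L.filter (· ≠ φ)) (fun ψ hψ => ?_)
      (h'.of_taut fun V hV => ?_)
    · rw [List.mem_filter] at hψ
      exact (hL ψ hψ.1).resolve_left (by simpa using hψ.2)
    · rw [imp_foldr_iff hV, imp_foldr_iff hV, hV.neg]
      intro h₁ h₂ h₃
      refine hV.falsum (h₁ fun ψ hψ => ?_)
      by_cases hψφ : ψ = φ
      · rwa [hψφ]
      · exact h₂ ψ (List.mem_filter.2 ⟨hψ, by simpa using hψφ⟩)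

theorem isHValuation_mem (hΓ : Maximal (· ∈ {Γ | Consistent T Γ}) Γ) :
    IsHValuation (· ∈ Γ) := by
  have hn := neg_mem_iff hΓ
  have hd (φ ψ χ : HExpr S .prop) (hφ : φ ∈ Γ) (hψ : ψ ∈ Γ)
      (h : ∀ V, IsHValuation V → V φ → V ψ → V χ) : χ ∈ Γ :=
    mem_of_taut hΓ [φ, ψ] (by simp [hφ, hψ]) fun V hV hL => h V hV (hL _ (by simp))
      (hL _ (by simp))
  -- The truth values of `φ` and `ψ` decide that of their combination by a connective.
  have ht (φ ψ χ : HExpr S .prop) (p : Prop → Prop → Prop)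
      (h : ∀ V, IsHValuation V → (V χ ↔ p (V φ) (V ψ))) : χ ∈ Γ ↔ p (φ ∈ Γ) (ψ ∈ Γ) := by
    obtain ⟨φ', hφ', hφV⟩ : ∃ φ' ∈ Γ, ∀ V, IsHValuation V → V φ' → (V φ ↔ φ ∈ Γ) := by
      by_cases hφ : φ ∈ Γ
      · exact ⟨φ, hφ, fun V hV h => by simp [h, hφ]⟩
      · exact ⟨φ.neg, (hn _).2 hφ, fun V hV h => by simpa [hφ] using (hV.neg _).1 h⟩
    obtain ⟨ψ', hψ', hψV⟩ : ∃ ψ' ∈ Γ, ∀ V, IsHValuation V → V ψ' → (V ψ ↔ ψ ∈ Γ) := by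
      by_cases hψ : ψ ∈ Γ
      · exact ⟨ψ, hψ, fun V hV h => by simp [h, hψ]⟩
      · exact ⟨ψ.neg, (hn _).2 hψ, fun V hV h => by simpa [hψ] using (hV.neg _).1 h⟩
    by_cases hp : p (φ ∈ Γ) (ψ ∈ Γ)
    · refine iff_of_true (hd φ' ψ' χ hφ' hψ' fun V hV h₁ h₂ => ?_) hp
      rwa [h V hV, hφV V hV h₁, hψV V hV h₂]
    · refine iff_of_false ((hn _).1 (hd φ' ψ' χ.neg hφ' hψ' fun V hV h₁ h₂ => ?_)) hp
      rwa [hV.neg, h V hV, hφV V hV h₁, hψV V hV h₂]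
  exact {
    verum := mem_of_taut hΓ [] (by simp) fun V hV _ => hV.verum
    falsum := (hn _).1 (mem_of_taut hΓ [] (by simp) fun V hV _ => (hV.neg _).2 hV.falsum)
    neg := hn
    imp := fun φ ψ => ht φ ψ _ (fun a b => a → b) fun V hV => hV.imp _ _
    and := fun φ ψ => ht φ ψ _ (fun a b => a ∧ b) fun V hV => hV.and _ _
    or := fun φ ψ => ht φ ψ _ (fun a b => a ∨ b) fun V hV => hV.or _ _
    iff := fun φ ψ => ht φ ψ _ (fun a b => a ↔ b) fun V hV => hV.iff _ _ }

end Maximal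

/-- A truth assignment to the enlarged formulas for which the derivable formulas and the Henkin
axioms are true. -/
structure IsHenkin (T : Set (Formula S)) (V : HExpr S .prop → Prop) : Prop extends
    IsHValuation V where
  of_derivable : ∀ φ, HDerivable T φ → V φ
  henkin : ∀ w, V (henkin w)

theorem exists_isHenkin {χ : HExpr S .prop} (hχ : χ.wits = ∅) (h : ¬ HDerivable T χ) :
    ∃ V, IsHenkin T V ∧ ¬ V χ := by
  obtain ⟨Γ, hsub, hΓ⟩ := (isOfFiniteCharacter_consistent T).exists_maximal
    (consistent_henkin hχ h)
  exact ⟨(· ∈ Γ),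
    { isHValuation_mem hΓ with
      of_derivable := fun φ hφ => mem_of_derivable hΓ (L := []) (by simp) hφ
      henkin := fun w => hsub (Or.inr ⟨w, rfl⟩) },
    (neg_mem_iff hΓ _).1 (hsub (Or.inl rfl))⟩

/-! ### Closed expressions -/

/-- The closed enlarged expressions of sort `γ`. -/
abbrev Cl (S : Signature.{u}) (γ : S.Srt) : Type u := {e : HExpr S γ // e.fv = ∅}

/-- The substitutions by closed expressions. -/
abbrev CEnv (S : Signature.{u}) : Type u := ∀ w : S.AVar, Cl S w.1.1

/-- `θ` changed to take the values `d` at the points `x`. -/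
noncomputable abbrev CEnv.over (θ : CEnv S) {σ : List S.VSrt} (x : Tup S.Var σ)
    (d : Tup (fun α : S.VSrt => Cl S α.1) σ) : CEnv S :=
  Tup.overwrite (B := fun α : S.VSrt => Cl S α.1) θ x d

namespace CEnv

/-- A substitution by closed expressions as a substitution. -/
def toEnv (θ : CEnv S) : Env S := fun w => (θ w).1

theorem toEnv_over (θ : CEnv S) {σ : List S.VSrt} (x : Tup S.Var σ)
    (d : Tup (fun α : S.VSrt => Cl S α.1) σ) :
    (θ.over x d).toEnv = θ.toEnv.over x (d.map fun _ => Subtype.val) :=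
  funext fun w => Tup.apply_overwrite (B := fun α : S.VSrt => Cl S α.1)
    (C := fun α : S.VSrt => HExpr S α.1) (fun _ => Subtype.val) x θ d w

theorem exists_cEnv (S : Signature.{u}) : Nonempty (CEnv S) :=
  ⟨fun w => ⟨.wit w.1 w.2 .verum, rfl⟩⟩

end CEnv

namespace HExpr

theorem subst_over_congr {γ : S.Srt} (e : HExpr S γ) {σ : List S.VSrt} {v : Tup S.Var σ}
    (h : ∀ w ∈ e.fv, w ∈ v.toList) (θ θ' : Env S) (d : Tup (fun α : S.VSrt => HExpr S α.1) σ) :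
    e.subst (θ.over v d) = e.subst (θ'.over v d) :=
  subst_congr e fun w hw => Tup.overwrite_congr _ _ _ _ fun hwv => absurd (h w hw) hwv

/-- The closed expression that results from the substitution of closed expressions for all the
variables. -/
noncomputable def inst {γ : S.Srt} (e : HExpr S γ) (θ : CEnv S) : Cl S γ :=
  ⟨e.subst θ.toEnv, Set.eq_empty_of_forall_notMem fun t ht => by
    obtain ⟨w, -, hw⟩ := mem_fv_subst e ht
    rw [CEnv.toEnv, (θ w).2] at hw
    exact hw⟩

theorem inst_of_closed {γ : S.Srt} (a : Cl S γ) (θ : CEnv S) : a.1.inst θ = a :=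
  Subtype.ext (subst_of_closed a.2 _)

/-- The expression that results from renaming `v` to `v'` and substituting closed expressions for
all other variables. -/
noncomputable def part {γ : S.Srt} (e : HExpr S γ) (θ : CEnv S) {σ : List S.VSrt}
    (v v' : Tup S.Var σ) : HExpr S γ :=
  e.subst (θ.toEnv.over v (vars v'))

theorem fv_over_vars (θ : CEnv S) {σ : List S.VSrt} (v v' : Tup S.Var σ) {w t : S.AVar}
    (ht : t ∈ (θ.toEnv.over v (vars v') w).fv) : w ∈ v.toList ∧ t ∈ v'.toList := by
  by_cases hw : w ∈ v.toList
  · refine ⟨hw, ?_⟩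
    refine Tup.overwrite_of_mem (fun α (b : HExpr S α.1) => ∀ t ∈ b.fv, t ∈ v'.toList) v θ.toEnv
      (vars v') (Tup.forall_mem_toList_map _ _ _ fun w hw t ht => ?_) hw t ht
    obtain rfl : t = w := ht
    exact hw
  · rw [over_of_notMem _ _ hw, CEnv.toEnv, (θ w).2] at ht
    exact ht.elim

theorem mem_of_mem_fv_part {γ : S.Srt} (e : HExpr S γ) (θ : CEnv S) {σ : List S.VSrt}
    (v v' : Tup S.Var σ) {t : S.AVar} (ht : t ∈ (e.part θ v v').fv) : t ∈ v'.toList := by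
  obtain ⟨w, -, ht⟩ := mem_fv_subst e ht
  exact (fv_over_vars θ v v' ht).2

theorem part_inst {γ : S.Srt} (e : HExpr S γ) (θ θ' : CEnv S) {σ : List S.VSrt}
    {v v' : Tup S.Var σ} (hv' : v'.toList.Nodup) (h : v' = v ∨ ∀ w ∈ v'.toList, w ∉ e.bv)
    (c : Tup (fun α : S.VSrt => Cl S α.1) σ) :
    (e.part θ v v').inst (θ'.over v' c) = e.inst (θ.over v c) := by
  refine Subtype.ext ((subst_subst e fun w _ => ?_).trans (congrArg _ (funext fun w => ?_)))
  · rcases h with rfl | h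
    · by_cases hw : w ∈ v'.toList
      · exact Or.inl (over_vars_of_mem _ hw)
      · exact Or.inr (Set.disjoint_left.2 fun t ht => absurd (fv_over_vars θ _ _ ht).1 hw)
    · exact Or.inr (Set.disjoint_left.2 fun t ht => h t (fv_over_vars θ _ _ ht).2)
  · rw [CEnv.toEnv_over, CEnv.toEnv_over]
    refine (Tup.apply_overwrite (B := fun α : S.VSrt => HExpr S α.1)
      (C := fun α : S.VSrt => HExpr S α.1)
      (fun _ b => b.subst (θ'.toEnv.over v' (c.map fun _ => Subtype.val))) v θ.toEnv _ w).trans ?_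
    have h₁ : (fun w => (θ.toEnv w).subst (θ'.toEnv.over v' (c.map fun _ => Subtype.val))) =
        θ.toEnv := funext fun w => subst_of_closed (θ w).2 _
    have h₂ : (vars v').map
        (fun _ b => b.subst (θ'.toEnv.over v' (c.map fun _ => Subtype.val))) =
        c.map fun _ => Subtype.val := by
      rw [vars, Tup.map_map]
      exact Tup.map_overwrite_self (B := fun α : S.VSrt => HExpr S α.1) v' _ _ hv'
    rw [h₁, h₂]

end HExpr

/-! ### Truth for a Henkin assignment -/

namespace IsHenkin

variable {V : HExpr S .prop → Prop}

theorem mp (hV : IsHenkin T V) {φ ψ : HExpr S .prop} (h : HDerivable T (φ.imp ψ)) (hφ : V φ) :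
    V ψ :=
  (hV.imp _ _).1 (hV.of_derivable _ h) hφ

theorem ex_iff (hV : IsHenkin T V) {α : S.VSrt} (x : S.Var α) (φ : HExpr S .prop) :
    V (ex x φ) ↔ ∃ d : Cl S α.1, V (φ.substOne x d.1) :=
  ⟨fun h => ⟨⟨wit α x φ, rfl⟩, (hV.imp _ _).1 (hV.henkin ⟨α, x, φ⟩) h⟩,
    fun ⟨d, hd⟩ => hV.mp (.ex_intro x d.2 φ) hd⟩

theorem all_iff (hV : IsHenkin T V) {α : S.VSrt} (x : S.Var α) (φ : HExpr S .prop) :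
    V (all x φ) ↔ ∀ d : Cl S α.1, V (φ.substOne x d.1) := by
  refine ⟨fun h d => hV.mp (.all_elim x d.2 φ) h, fun h => hV.mp (.not_ex_not_imp_all x φ) ?_⟩
  rw [hV.neg, hV.ex_iff]
  rintro ⟨d, hd⟩
  rw [substOne, neg_subst, hV.neg] at hd
  exact hd (h d)

/-- A universal statement is true if all its closed instances are true. -/
theorem allSeq (hV : IsHenkin T V) : ∀ {σ : List S.VSrt} (z : Tup S.Var σ) (χ : HExpr S .prop),
    (∀ c : Tup (fun α : S.VSrt => Cl S α.1) σ,
      V (χ.subst ((Env.id S).over z (c.map fun _ => Subtype.val)))) → V (allSeq z χ)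
  | _, .nil, χ, h => by
    have := h .nil
    rwa [show (Env.id S).over .nil (Tup.map _ .nil) = Env.id S from rfl, subst_id] at this
  | _, @Tup.cons _ _ α _ x z, χ, h => by
    rw [HExpr.allSeq, hV.all_iff]
    intro d
    rw [substOne, allSeq_subst]
    refine allSeq hV z _ fun c => ?_
    have := h (.cons d c)
    convert this using 1
    refine (subst_subst χ fun w _ => ?_).trans (congrArg _ (funext fun w => ?_))
    · by_cases hwz : w ∈ z.toList
      · exact Or.inl (over_vars_of_mem _ hwz)
      · rw [over_of_notMem _ _ hwz]
        by_cases hw : w = ⟨α, x⟩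
        · subst hw
          rw [Env.over, Tup.overwrite_single_self, d.2]
          exact Or.inr (Set.empty_disjoint _)
        · exact Or.inl (Tup.overwrite_single_of_ne _ _ _ hw)
    · change _ = ((Env.id S).over (Tup.single x) (Tup.single d.1)).over z _ w
      by_cases hwz : w ∈ z.toList
      · rw [over_vars_of_mem _ hwz]
        exact Tup.overwrite_congr _ _ _ _ fun h => absurd hwz h
      · rw [over_of_notMem _ _ hwz, over_of_notMem _ _ hwz]
        by_cases hw : w = ⟨α, x⟩
        · subst hw
          rw [Env.over, Tup.overwrite_single_self]
          exact subst_of_closed d.2 _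
        · rw [Env.over, Tup.overwrite_single_of_ne _ _ _ hw]
          exact over_of_notMem _ _ hwz

theorem equal_refl (hV : IsHenkin T V) {γ : S.Srt} (a : HExpr S γ) : V (a.equal a) :=
  hV.of_derivable _ (.eq_refl a)

theorem equal_congr_left (hV : IsHenkin T V) : ∀ {γ : S.Srt} {a b : HExpr S γ} (c : HExpr S γ),
    V (a.equal b) → (V (a.equal c) ↔ V (b.equal c))
  | .prop, a, b, c, h => by
    have h := (hV.iff _ _).1 h
    exact (hV.iff _ _).trans ((iff_congr h Iff.rfl).trans (hV.iff _ _).symm)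
  | .ind i, a, b, c, h => by
    have h' := HDerivable.eq_congr (T := T) (.eq i) (fun _ => Tup.nil) (fun _ => Tup.nil)
      (fun _ => List.nodup_nil) (fun _ => List.nodup_nil) ![a, c] ![b, c] (0 : Fin 2)
      (fun j hj => ⟨rfl, by
        match j with
        | 0 => exact absurd rfl hj
        | 1 => rfl⟩) Tup.nil List.nodup_nil (by simp [Tup.toList]) (by simp [Tup.toList])
    refine (hV.iff _ _).1 (hV.mp h' ?_)
    change V ((a.subst (Env.id S)).equal (b.subst (Env.id S)))
    rwa [subst_id, subst_id]

theorem equal_symm (hV : IsHenkin T V) {γ : S.Srt} {a b : HExpr S γ} (h : V (a.equal b)) :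
    V (b.equal a) :=
  (hV.equal_congr_left a h).1 (hV.equal_refl a)

theorem equal_trans (hV : IsHenkin T V) {γ : S.Srt} {a b c : HExpr S γ} (h : V (a.equal b))
    (h' : V (b.equal c)) : V (a.equal c) :=
  (hV.equal_congr_left c h).2 h'

/-- The congruence property for two applications that differ in a single argument place. -/
theorem app_congr_place (hV : IsHenkin T V) (o : Sym S)
    (v w : ∀ i : Fin o.rank.len, Tup S.Var (o.rank.bnd i))
    (hv : ∀ i, (v i).toList.Nodup) (hw : ∀ i, (w i).toList.Nodup)
    (a b : ∀ i : Fin o.rank.len, HExpr S (o.rank.arg i)) (i : Fin o.rank.len)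
    (hother : ∀ j, j ≠ i → v j = w j ∧ a j = b j)
    (ha : ∀ t ∈ (a i).fv, t ∈ (v i).toList) (hb : ∀ t ∈ (b i).fv, t ∈ (w i).toList)
    (h : ∀ (θ : CEnv S) (c : Tup (fun α : S.VSrt => Cl S α.1) (o.rank.bnd i)),
      V (((a i).inst (θ.over (v i) c)).1.equal ((b i).inst (θ.over (w i) c)).1)) :
    V ((app o v hv a).equal (app o w hw b)) := by
  obtain ⟨z, hz, hzF⟩ := Tup.exists_fresh S.var_infinite (o.rank.bnd i)
    (((a i).finite_fv.union (b i).finite_fv).union ((a i).finite_bv.union (b i).finite_bv))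
  refine hV.mp (.eq_congr o v w hv hw a b i hother z hz (fun t ht h => hzF t ht (Or.inl h))
    (fun t ht h => hzF t ht (Or.inr h))) (hV.allSeq z _ fun c => ?_)
  obtain ⟨θ⟩ := CEnv.exists_cEnv S
  have key {γ : S.Srt} (e : HExpr S γ) (x : Tup S.Var (o.rank.bnd i))
      (he : ∀ t ∈ e.fv, t ∈ x.toList) (hze : ∀ t ∈ z.toList, t ∉ e.bv) :
      (e.subst ((Env.id S).over x (vars z))).subst
        ((Env.id S).over z (c.map fun _ => Subtype.val)) = (e.inst (θ.over x c)).1 := by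
    rw [← part_inst e θ θ hz (Or.inr hze), subst_over_congr e he _ θ.toEnv]
    change _ = (e.part θ x z).subst (θ.over z c).toEnv
    rw [CEnv.toEnv_over]
    exact subst_over_congr _ (fun t ht => mem_of_mem_fv_part e θ x z ht) _ _ _
  rw [equal_subst, key (a i) (v i) ha fun t ht h => hzF t ht (Or.inr (Or.inl h)),
    key (b i) (w i) hb fun t ht h => hzF t ht (Or.inr (Or.inr h))]
  exact h θ c

/-- Applications of `o` to arguments with equal instances are equal. The arguments are exchanged one
place at a time. -/
theorem app_congr (hV : IsHenkin T V) (o : Sym S)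
    (v w : ∀ i : Fin o.rank.len, Tup S.Var (o.rank.bnd i))
    (hv : ∀ i, (v i).toList.Nodup) (hw : ∀ i, (w i).toList.Nodup)
    (a b : ∀ i : Fin o.rank.len, HExpr S (o.rank.arg i))
    (ha : ∀ i, ∀ t ∈ (a i).fv, t ∈ (v i).toList) (hb : ∀ i, ∀ t ∈ (b i).fv, t ∈ (w i).toList)
    (h : ∀ i (θ : CEnv S) (c : Tup (fun α : S.VSrt => Cl S α.1) (o.rank.bnd i)),
      V (((a i).inst (θ.over (v i) c)).1.equal ((b i).inst (θ.over (w i) c)).1)) :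
    V ((app o v hv a).equal (app o w hw b)) := by
  classical
  have key (s : Finset (Fin o.rank.len)) (hs : ∀ i, (s.piecewise w v i).toList.Nodup) :
      V ((app o v hv a).equal (app o (s.piecewise w v) hs (s.piecewise b a))) := by
    induction s using Finset.induction_on with
    | empty => simpa using hV.equal_refl _
    | insert j s hj ih =>
      have hs' : ∀ i, (s.piecewise w v i).toList.Nodup := fun i => by
        by_cases hi : i ∈ s
        · simpa [hi] using hw i
        · simpa [hi] using hv i
      refine hV.equal_trans (ih hs') (hV.app_congr_place o _ _ hs' hs _ _ j ?_ ?_ ?_ ?_)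
      · intro i hi
        simp [Finset.piecewise_insert_of_ne _ _ _ hi]
      · simpa [hj] using ha j
      · simpa using hb j
      · simpa [hj] using h j
  simpa using key Finset.univ (by simpa using hw)

/-! ### The term structure -/

/-- Equality of closed expressions according to `V`. -/
def setoid (hV : IsHenkin T V) (γ : S.Srt) : Setoid (Cl S γ) where
  r a b := V (a.1.equal b.1)
  iseqv := ⟨fun _ => hV.equal_refl _, hV.equal_symm, hV.equal_trans⟩

/-- The range of the sort `γ` in the term structure: the classes of the closed expressions of sort
`γ`. If there are no closed expressions of that sort, the range is a one-point set. -/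
def Carrier (hV : IsHenkin T V) (γ : S.Srt) : Type u :=
  Quotient (hV.setoid γ) ⊕ PLift (IsEmpty (Cl S γ))

/-- The class of a closed expression. -/
def cls (hV : IsHenkin T V) {γ : S.Srt} (a : Cl S γ) : hV.Carrier γ := Sum.inl (Quotient.mk _ a)

theorem cls_eq_iff (hV : IsHenkin T V) {γ : S.Srt} {a b : Cl S γ} :
    hV.cls a = hV.cls b ↔ V (a.1.equal b.1) :=
  Sum.inl_injective.eq_iff.trans Quotient.eq

theorem cls_surjective (hV : IsHenkin T V) {γ : S.Srt} (h : Nonempty (Cl S γ)) :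
    Function.Surjective (hV.cls (γ := γ))
  | .inl q => by
    obtain ⟨a, rfl⟩ := Quotient.exists_rep q
    exact ⟨a, rfl⟩
  | .inr p => (not_isEmpty_iff.2 h p.down).elim

theorem nonempty_cl (α : S.VSrt) : Nonempty (Cl S α.1) :=
  ⟨⟨.wit α (@Infinite.nonempty _ (S.var_infinite α)).some .verum, rfl⟩⟩

theorem nonempty_carrier (hV : IsHenkin T V) (γ : S.Srt) : Nonempty (hV.Carrier γ) := by
  by_cases h : Nonempty (Cl S γ)
  · exact h.map hV.cls
  · exact ⟨.inr ⟨not_nonempty_iff.1 h⟩⟩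

theorem exists_map_cls (hV : IsHenkin T V) {σ : List S.VSrt}
    (y : Tup (fun α : S.VSrt => hV.Carrier α.1) σ) :
    ∃ d : Tup (fun α : S.VSrt => Cl S α.1) σ, d.map (fun _ => hV.cls) = y :=
  Tup.exists_map_eq (fun α => hV.cls_surjective (nonempty_cl α)) y

/-- The function `g` maps the classes of closed expressions `c` to the class of the result of
substituting the `c` for the variables `v` in `e` and the values of `θ` for the other variables. -/
def RepresentsAt (hV : IsHenkin T V) {γ : S.Srt} {σ : List S.VSrt}
    (g : Tup (fun α : S.VSrt => hV.Carrier α.1) σ → hV.Carrier γ) (e : HExpr S γ)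
    (v : Tup S.Var σ) (θ : CEnv S) : Prop :=
  ∀ c : Tup (fun α : S.VSrt => Cl S α.1) σ,
    g (c.map fun _ => hV.cls) = hV.cls (e.inst (θ.over v c))

/-- The function `g` is represented by the expression `e` in the variables `v`, which has no other
free variables. -/
def Represents (hV : IsHenkin T V) {γ : S.Srt} {σ : List S.VSrt}
    (g : Tup (fun α : S.VSrt => hV.Carrier α.1) σ → hV.Carrier γ) (e : HExpr S γ)
    (v : Tup S.Var σ) : Prop :=
  (∀ t ∈ e.fv, t ∈ v.toList) ∧ ∀ θ, hV.RepresentsAt g e v θ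

theorem RepresentsAt.represents_part {hV : IsHenkin T V} {γ : S.Srt} {σ : List S.VSrt}
    {g : Tup (fun α : S.VSrt => hV.Carrier α.1) σ → hV.Carrier γ} {e : HExpr S γ}
    {v : Tup S.Var σ} {θ : CEnv S} (h : hV.RepresentsAt g e v θ) {v' : Tup S.Var σ}
    (hv' : v'.toList.Nodup) (hve : v' = v ∨ ∀ w ∈ v'.toList, w ∉ e.bv) :
    hV.Represents g (e.part θ v v') v' :=
  ⟨fun _ => mem_of_mem_fv_part e θ v v', fun θ' c => by rw [h c, part_inst e θ θ' hv' hve]⟩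

/-- The functions selected for the term structure: those represented by some expression. If there
are no closed expressions of sort `γ`, the only function is selected. -/
def FnSet (hV : IsHenkin T V) (γ : S.Srt) (σ : List S.VSrt) :
    Set (Tup (fun α : S.VSrt => hV.Carrier α.1) σ → hV.Carrier γ) :=
  {g | IsEmpty (Cl S γ) ∨ ∃ e v θ, v.toList.Nodup ∧ hV.RepresentsAt g e v θ}

theorem const_mem_fnSet (hV : IsHenkin T V) (γ : S.Srt) (σ : List S.VSrt) (w : hV.Carrier γ) :
    (fun _ => w) ∈ hV.FnSet γ σ := by
  by_cases h : Nonempty (Cl S γ)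
  · obtain ⟨a, rfl⟩ := hV.cls_surjective h w
    obtain ⟨v, hv, -⟩ := Tup.exists_fresh S.var_infinite σ Set.finite_empty
    obtain ⟨θ⟩ := CEnv.exists_cEnv S
    exact Or.inr ⟨a.1, v, θ, hv, fun c => by rw [inst_of_closed]⟩
  · exact Or.inl (not_nonempty_iff.1 h)

theorem proj_mem_fnSet (hV : IsHenkin T V) (σ : List S.VSrt) (j : Fin σ.length) :
    (fun x => x.get j) ∈ hV.FnSet (σ.get j).1 σ := by
  obtain ⟨v, hv, -⟩ := Tup.exists_fresh S.var_infinite σ Set.finite_empty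
  obtain ⟨θ⟩ := CEnv.exists_cEnv S
  refine Or.inr ⟨.var (σ.get j) (v.get j), v, θ, hv, fun c => ?_⟩
  change (Tup.map (fun _ => hV.cls) c).get j = hV.cls (θ.over v c ⟨_, v.get j⟩)
  rw [Tup.get_map]
  congr 1
  conv_lhs => rw [← Tup.map_overwrite_self (B := fun α : S.VSrt => Cl S α.1) v θ c hv]
  exact Tup.get_map (B := fun α : S.VSrt => Cl S α.1) (fun α x => θ.over v c ⟨α, x⟩) v j

theorem fix_mem_fnSet (hV : IsHenkin T V) (γ : S.Srt) (σ ρ : List S.VSrt)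
    (x : Tup (fun α : S.VSrt => hV.Carrier α.1) σ) :
    ∀ g ∈ hV.FnSet γ (σ ++ ρ), (fun r => g (x.append r)) ∈ hV.FnSet γ ρ := by
  rintro g (h | ⟨e, v, θ, hv, h⟩)
  · exact Or.inl h
  · obtain ⟨v₁, v₂, rfl⟩ := Tup.exists_append v
    obtain ⟨d, rfl⟩ := hV.exists_map_cls x
    rw [Tup.toList_append, List.nodup_append] at hv
    refine Or.inr ⟨e, v₂, θ.over v₁ d, hv.2.1, fun c => ?_⟩
    change g ((Tup.map _ d).append (Tup.map _ c)) = _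
    rw [← Tup.map_append, h, CEnv.over, Tup.overwrite_append]

/-- The closed expression `a` is an application of `o` to arguments that represent `g`. -/
def IsApp (hV : IsHenkin T V) (o : Sym S)
    (g : ∀ i : Fin o.rank.len, hV.FnSet (o.rank.arg i) (o.rank.bnd i)) (a : Cl S o.rank.res) :
    Prop :=
  ∃ v hv e, a.1 = app o v hv e ∧ ∀ i, hV.Represents (g i).1 (e i) (v i)

theorem fv_verum : (verum : HExpr S .prop).fv = ∅ :=
  Set.iUnion_eq_empty.2 fun i => i.elim0

/-- An element of the range of `γ`; for `γ = prop` it is the class of `⊤`. -/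
noncomputable def default (hV : IsHenkin T V) : ∀ γ : S.Srt, hV.Carrier γ
  | .prop => hV.cls ⟨verum, fv_verum⟩
  | .ind i => Classical.choice (hV.nonempty_carrier (.ind i))

open Classical in
/-- The interpretation of the symbolic operations in the term structure. The arguments of `o` are
not represented by expressions only if there are no expressions `o(…)`; then the value is a
constant. This constant is `⊤` if `o` is the equality of a sort without closed expressions, as it
has to be because the range of the sort has only one element. -/
noncomputable def interp (hV : IsHenkin T V) (o : Sym S)
    (g : ∀ i : Fin o.rank.len, hV.FnSet (o.rank.arg i) (o.rank.bnd i)) : hV.Carrier o.rank.res :=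
  if h : ∃ a, hV.IsApp o g a then hV.cls h.choose
  else hV.default o.rank.res

/-- The value of `o` does not depend on the representation of the arguments. -/
theorem interp_eq_of_isApp (hV : IsHenkin T V) {o : Sym S}
    {g : ∀ i : Fin o.rank.len, hV.FnSet (o.rank.arg i) (o.rank.bnd i)} {a : Cl S o.rank.res}
    (ha : hV.IsApp o g a) : hV.interp o g = hV.cls a := by
  have h : ∃ a, hV.IsApp o g a := ⟨a, ha⟩
  rw [interp, dif_pos h, cls_eq_iff]
  obtain ⟨v, hv, e, hve, hg⟩ := h.choose_spec
  obtain ⟨w, hw, e', hwe, hg'⟩ := ha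
  rw [hve, hwe]
  refine hV.app_congr o v w hv hw e e' (fun i => (hg i).1) (fun i => (hg' i).1) fun i θ c => ?_
  rw [← hV.cls_eq_iff, ← (hg i).2 θ c, (hg' i).2 θ c]

theorem interp_eq (hV : IsHenkin T V) {o : Sym S}
    {g : ∀ i : Fin o.rank.len, hV.FnSet (o.rank.arg i) (o.rank.bnd i)}
    (v : ∀ i : Fin o.rank.len, Tup S.Var (o.rank.bnd i)) (hv : ∀ i, (v i).toList.Nodup)
    (e : ∀ i : Fin o.rank.len, HExpr S (o.rank.arg i))
    (h : ∀ i, hV.Represents (g i).1 (e i) (v i)) :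
    ∃ hcl, hV.interp o g = hV.cls ⟨app o v hv e, hcl⟩ := by
  refine ⟨?_, hV.interp_eq_of_isApp ⟨v, hv, e, rfl, h⟩⟩
  exact Set.iUnion_eq_empty.2 fun i => Set.sdiff_eq_empty.2 (h i).1

theorem interp_eq_inst (hV : IsHenkin T V) {o : Sym S}
    {g : ∀ i : Fin o.rank.len, hV.FnSet (o.rank.arg i) (o.rank.bnd i)}
    (v : ∀ i : Fin o.rank.len, Tup S.Var (o.rank.bnd i)) (hv : ∀ i, (v i).toList.Nodup)
    (e : ∀ i : Fin o.rank.len, HExpr S (o.rank.arg i)) (θ : CEnv S)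
    (h : ∀ i, hV.RepresentsAt (g i).1 (e i) (v i) θ) :
    hV.interp o g = hV.cls ((app o v hv e).inst θ) :=
  (hV.interp_eq v hv _ fun i => (h i).represents_part (hv i) (Or.inl rfl)).2

theorem interp_of_isEmpty (hV : IsHenkin T V) {o : Sym S}
    {g : ∀ i : Fin o.rank.len, hV.FnSet (o.rank.arg i) (o.rank.bnd i)} (i : Fin o.rank.len)
    (h : IsEmpty (Cl S (o.rank.arg i))) : hV.interp o g = hV.default o.rank.res := by
  refine dif_neg ?_
  rintro ⟨a, v, hv, e, -, -⟩
  obtain ⟨θ⟩ := CEnv.exists_cEnv S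
  exact h.false ((e i).inst θ)

theorem comp_mem_fnSet (hV : IsHenkin T V) (σ : List S.VSrt) (o : Sym S)
    (g : ∀ i : Fin o.rank.len, hV.FnSet (o.rank.arg i) (σ ++ o.rank.bnd i)) :
    (fun y => hV.interp o fun i =>
      ⟨fun z => (g i).1 (y.append z), hV.fix_mem_fnSet _ _ _ y _ (g i).2⟩) ∈
      hV.FnSet o.rank.res σ := by
  by_cases h : ∀ i, Nonempty (Cl S (o.rank.arg i))
  · choose e x θ hx hrep using fun i => (g i).2.resolve_left (not_isEmpty_iff.2 (h i))
    obtain ⟨θ₀⟩ := CEnv.exists_cEnv S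
    -- The representations of the arguments have to start with the same variables, which must not
    -- get bound in any of them.
    have hF : (⋃ i, (e i).bv).Finite := Set.finite_iUnion fun i => (e i).finite_bv
    obtain ⟨u, hu, huF⟩ := Tup.exists_fresh S.var_infinite σ hF
    choose z hz hzF using fun i => Tup.exists_fresh S.var_infinite (o.rank.bnd i)
      (hF.union (List.finite_toSet u.toList))
    have hrep' (i) : hV.Represents (g i).1 ((e i).part (θ i) (x i) (u.append (z i)))
        (u.append (z i)) := by
      refine (hrep i).represents_part ?_ (Or.inr fun w hw => ?_)
      · rw [Tup.toList_append, List.nodup_append]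
        refine ⟨hu, hz i, fun a ha b hb hab => hzF i b hb (Or.inr ?_)⟩
        exact hab ▸ ha
      · rw [Tup.toList_append, List.mem_append] at hw
        rcases hw with hw | hw
        · exact fun h => huF w hw (Set.mem_iUnion.2 ⟨i, h⟩)
        · exact fun h => hzF i w hw (Or.inl (Set.mem_iUnion.2 ⟨i, h⟩))
    refine Or.inr ⟨app o z hz fun i => (e i).part (θ i) (x i) (u.append (z i)), u, θ₀, hu,
      fun d => hV.interp_eq_inst z hz _ _ fun i c => ?_⟩
    change (g i).1 _ = _
    rw [← Tup.map_append, (hrep' i).2 θ₀, CEnv.over, Tup.overwrite_append]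
  · obtain ⟨i, hi⟩ := not_forall.1 h
    simp only [hV.interp_of_isEmpty i (not_nonempty_iff.1 hi)]
    exact hV.const_mem_fnSet _ _ _

theorem represents_nil (hV : IsHenkin T V) {γ : S.Srt}
    {g : Tup (fun α : S.VSrt => hV.Carrier α.1) [] → hV.Carrier γ} {a : Cl S γ}
    (h : hV.cls a = g .nil) : hV.Represents g a.1 .nil :=
  ⟨by simp [a.2], fun θ c => by cases c; rw [inst_of_closed, h]; rfl⟩

theorem fnSet_nil (hV : IsHenkin T V) (γ : S.Srt) : hV.FnSet γ [] = Set.univ := by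
  refine Set.eq_univ_of_forall fun g => ?_
  by_cases h : Nonempty (Cl S γ)
  · obtain ⟨a, ha⟩ := hV.cls_surjective h (g .nil)
    obtain ⟨θ⟩ := CEnv.exists_cEnv S
    exact Or.inr ⟨a.1, .nil, θ, List.nodup_nil, (hV.represents_nil ha).2 θ⟩
  · exact Or.inl (not_nonempty_iff.1 h)

/-- The term structure, without the conditions on the logical symbols. -/
noncomputable def preStructure (hV : IsHenkin T V) : PreStructure S where
  carrier := hV.Carrier
  carrier_nonempty := hV.nonempty_carrier
  Fn := hV.FnSet
  fn_nil := hV.fnSet_nil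
  interp := hV.interp
  const_mem := hV.const_mem_fnSet
  proj_mem := hV.proj_mem_fnSet
  fix_mem := hV.fix_mem_fnSet
  comp_mem := hV.comp_mem_fnSet

theorem cls_eq_tt_iff (hV : IsHenkin T V) (a : Cl S .prop) :
    hV.cls a = hV.preStructure.tt ↔ V a.1 := by
  obtain ⟨h, e⟩ := hV.interp_eq (o := .verum) (g := fun i => i.elim0) (fun _ => Tup.nil)
    (fun _ => List.nodup_nil) (fun i => i.elim0) (fun i => i.elim0)
  have e' : hV.preStructure.tt = hV.cls ⟨verum, h⟩ := e
  rw [e', cls_eq_iff]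
  exact (hV.iff _ _).trans (by simp [hV.verum])

theorem cls_eq_ff_iff (hV : IsHenkin T V) (a : Cl S .prop) :
    hV.cls a = hV.preStructure.ff ↔ ¬ V a.1 := by
  obtain ⟨h, e⟩ := hV.interp_eq (o := .falsum) (g := fun i => i.elim0) (fun _ => Tup.nil)
    (fun _ => List.nodup_nil) (fun i => i.elim0) (fun i => i.elim0)
  have e' : hV.preStructure.ff = hV.cls ⟨falsum, h⟩ := e
  rw [e', cls_eq_iff]
  exact (hV.iff _ _).trans (by simp [hV.falsum])

theorem exists_cls_eq_prop (hV : IsHenkin T V) (p : hV.Carrier .prop) : ∃ a, hV.cls a = p :=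
  hV.cls_surjective ⟨⟨verum, fv_verum⟩⟩ p

/-- The value of a propositional connective with two arguments. -/
theorem interp_connective (hV : IsHenkin T V) {c : HExpr S .prop → HExpr S .prop → HExpr S .prop}
    {p : Prop → Prop → Prop} (hc : ∀ φ ψ, V (c φ ψ) ↔ p (V φ) (V ψ))
    {g : Fin 2 → hV.FnSet .prop []} {x : hV.Carrier .prop}
    (h : ∀ e : Fin 2 → HExpr S .prop, (∀ i, hV.Represents (g i).1 (e i) .nil) →
      ∃ hcl, x = hV.cls ⟨c (e 0) (e 1), hcl⟩) :
    x = hV.preStructure.tt ↔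
      p ((g 0).1 .nil = hV.preStructure.tt) ((g 1).1 .nil = hV.preStructure.tt) := by
  choose a ha using fun i => hV.exists_cls_eq_prop ((g i).1 .nil)
  obtain ⟨hcl, e⟩ := h (fun i => (a i).1) fun i => hV.represents_nil (ha i)
  rw [e, cls_eq_tt_iff, hc, ← ha, ← ha, cls_eq_tt_iff, cls_eq_tt_iff]

theorem exists_represents_single (hV : IsHenkin T V) {α : S.VSrt} (g : hV.FnSet .prop [α]) :
    ∃ (x : S.Var α) (φ : HExpr S .prop), hV.Represents g.1 φ (Tup.single x) ∧
      ∀ d : Cl S α.1, g.1 (Tup.single (hV.cls d)) = hV.preStructure.tt ↔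
        V (φ.substOne x d.1) := by
  obtain ⟨e, v, θ, hv, h⟩ := g.2.resolve_left (not_isEmpty_iff.2 ⟨⟨verum, fv_verum⟩⟩)
  have h' := h.represents_part hv (Or.inl rfl)
  match v with
  | .cons x .nil =>
    refine ⟨x, _, h', fun d => ?_⟩
    have := h'.2 θ (Tup.single d)
    change g.1 (Tup.single (hV.cls d)) = _ at this
    rw [this, cls_eq_tt_iff, substOne, subst_over_congr _ h'.1 _ θ.toEnv]
    change V (HExpr.subst _ (θ.over (Tup.single x) (Tup.single d)).toEnv) ↔ _
    rw [CEnv.toEnv_over]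
    rfl

theorem forall_fin_two_represents {hV : IsHenkin T V} {γ : S.Srt} {g : Fin 2 → hV.FnSet γ []}
    {a b : HExpr S γ} (ha : hV.Represents (g 0).1 a .nil) (hb : hV.Represents (g 1).1 b .nil) :
    ∀ i : Fin 2, hV.Represents (g i).1 ((![a, b] : Fin 2 → HExpr S γ) i) .nil
  | 0 => ha
  | 1 => hb

/-- The term structure. -/
noncomputable def termStructure (hV : IsHenkin T V) : Structure S where
  toPreStructure := hV.preStructure
  tt_ne_ff h := by
    obtain ⟨a, ha⟩ := hV.exists_cls_eq_prop hV.preStructure.tt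
    exact (hV.cls_eq_ff_iff a).1 (ha.trans h) ((hV.cls_eq_tt_iff a).1 ha)
  eq_tt_or_ff p := by
    obtain ⟨a, rfl⟩ := hV.exists_cls_eq_prop p
    by_cases h : V a.1
    · exact Or.inl ((hV.cls_eq_tt_iff a).2 h)
    · exact Or.inr ((hV.cls_eq_ff_iff a).2 h)
  interp_neg g := by
    obtain ⟨a, ha⟩ := hV.exists_cls_eq_prop ((g 0).1 .nil)
    obtain ⟨hcl, e⟩ := hV.interp_eq (o := .neg) (g := g) (fun _ => .nil)
      (fun _ => List.nodup_nil) (fun _ => a.1) fun i => by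
        rw [Subsingleton.elim i 0]; exact hV.represents_nil ha
    change hV.interp .neg g = hV.preStructure.tt ↔ ¬ (g 0).1 .nil = hV.preStructure.tt
    rw [e, ← ha]
    exact (hV.cls_eq_tt_iff ⟨HExpr.neg a.1, hcl⟩).trans
      ((hV.neg a.1).trans (not_congr (hV.cls_eq_tt_iff a).symm))
  interp_imp g := hV.interp_connective (p := fun a b => a → b) hV.imp fun _ h =>
    hV.interp_eq (o := .imp) (fun _ => Tup.nil) (fun _ => List.nodup_nil) _
      (forall_fin_two_represents (h 0) (h 1))
  interp_and g := hV.interp_connective (p := fun a b => a ∧ b) hV.and fun _ h =>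
    hV.interp_eq (o := .and) (fun _ => Tup.nil) (fun _ => List.nodup_nil) _
      (forall_fin_two_represents (h 0) (h 1))
  interp_or g := hV.interp_connective (p := fun a b => a ∨ b) hV.or fun _ h =>
    hV.interp_eq (o := .or) (fun _ => Tup.nil) (fun _ => List.nodup_nil) _
      (forall_fin_two_represents (h 0) (h 1))
  interp_iff g := hV.interp_connective (p := fun a b => a ↔ b) hV.iff fun _ h =>
    hV.interp_eq (o := .iff) (fun _ => Tup.nil) (fun _ => List.nodup_nil) _
      (forall_fin_two_represents (h 0) (h 1))
  interp_all α g := by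
    obtain ⟨x, φ, hφ, hd⟩ := hV.exists_represents_single (g 0)
    obtain ⟨hcl, e⟩ := hV.interp_eq (o := .all α) (g := g) (fun _ => Tup.single x)
      (fun _ => List.nodup_singleton _) (fun _ => φ) fun i => by
        rw [Subsingleton.elim i 0]; exact hφ
    change hV.interp (.all α) g = hV.preStructure.tt ↔ _
    rw [e]
    exact (hV.cls_eq_tt_iff _).trans <| (hV.all_iff x φ).trans <|
      (forall_congr' fun d => (hd d).symm).trans ((hV.cls_surjective (nonempty_cl α)).forall
        (p := fun y => (g 0).1 (Tup.single y) = hV.preStructure.tt)).symm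
  interp_ex α g := by
    obtain ⟨x, φ, hφ, hd⟩ := hV.exists_represents_single (g 0)
    obtain ⟨hcl, e⟩ := hV.interp_eq (o := .ex α) (g := g) (fun _ => Tup.single x)
      (fun _ => List.nodup_singleton _) (fun _ => φ) fun i => by
        rw [Subsingleton.elim i 0]; exact hφ
    change hV.interp (.ex α) g = hV.preStructure.tt ↔ _
    rw [e]
    exact (hV.cls_eq_tt_iff _).trans <| (hV.ex_iff x φ).trans <|
      (exists_congr fun d => (hd d).symm).trans ((hV.cls_surjective (nonempty_cl α)).exists
        (p := fun y => (g 0).1 (Tup.single y) = hV.preStructure.tt)).symm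
  interp_eq j g := by
    change hV.interp (.eq j) g = hV.preStructure.tt ↔ (g 0).1 .nil = (g 1).1 .nil
    by_cases hne : Nonempty (Cl S (.ind j))
    · obtain ⟨a, ha⟩ := hV.cls_surjective hne ((g 0).1 .nil)
      obtain ⟨b, hb⟩ := hV.cls_surjective hne ((g 1).1 .nil)
      obtain ⟨hcl, e⟩ := hV.interp_eq (o := .eq j) (g := g) (fun _ => .nil)
        (fun _ => List.nodup_nil) ![a.1, b.1]
        (forall_fin_two_represents (hV.represents_nil ha) (hV.represents_nil hb))
      rw [e, ← ha, ← hb]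
      exact (hV.cls_eq_tt_iff _).trans (hV.cls_eq_iff (a := a) (b := b)).symm
    · have h : IsEmpty (Cl S (.ind j)) := not_nonempty_iff.1 hne
      refine iff_of_true ?_ ?_
      · exact (hV.interp_of_isEmpty (o := .eq j) (0 : Fin 2) h).trans
          ((hV.cls_eq_tt_iff _).2 hV.verum)
      · rcases (g 0).1 .nil with q | p
        · exact (hne ⟨q.out⟩).elim
        · rcases (g 1).1 .nil with q | p'
          · exact (hne ⟨q.out⟩).elim
          · exact congrArg Sum.inr (Subsingleton.elim p p')

/-- `PreStructure.varVal` gives an arbitrary value to the variables outside of the given sequence.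
Representatives of these values make up a substitution to start from. -/
theorem exists_cls_eq_choice (hV : IsHenkin T V) : ∃ θ : CEnv S, ∀ w : S.AVar,
    hV.cls (θ w) = Classical.choice (hV.termStructure.carrier_nonempty w.1.1) := by
  choose θ hθ using fun w : S.AVar => hV.cls_surjective (nonempty_cl w.1)
    (Classical.choice (hV.termStructure.carrier_nonempty w.1.1))
  exact ⟨θ, hθ⟩

/-- The value of an expression in the term structure is the class of the expression that results
from substituting the values of its variables. -/
theorem eval_termStructure (hV : IsHenkin T V) {θ : CEnv S} (hθ : ∀ w : S.AVar,
    hV.cls (θ w) = Classical.choice (hV.termStructure.carrier_nonempty w.1.1)) :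
    ∀ {γ : S.Srt} (e : Expr S γ) (σ : List S.VSrt) (u : Tup S.Var σ)
      (d : Tup (fun α : S.VSrt => Cl S α.1) σ),
      (hV.termStructure.eval e σ u).1 (d.map fun _ => hV.cls) =
        hV.cls ((ofExpr e).inst (θ.over u d))
  | _, .var α x, σ, u, d => by
    refine Eq.trans ?_ (Tup.apply_overwrite (B := fun α : S.VSrt => Cl S α.1)
      (C := fun α : S.VSrt => hV.Carrier α.1) (fun _ => hV.cls) u θ d ⟨α, x⟩).symm
    simp only [hθ]
    rfl
  | _, .app o v hv a, σ, u, d => by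
    refine hV.interp_eq_inst v hv (fun i => ofExpr (a i)) (θ.over u d) fun i c => ?_
    change (hV.termStructure.eval (a i) _ _).1 ((Tup.map (fun _ => hV.cls) d).append
      (Tup.map (fun _ => hV.cls) c)) = _
    rw [← Tup.map_append, eval_termStructure hV hθ (a i), CEnv.over, Tup.overwrite_append]

end IsHenkin

/-! ### Completeness -/

theorem HDerivable.subst_toEnv {φ : HExpr S .prop} (h : HDerivable T φ)
    (θ : CEnv S) : HDerivable T (φ.subst θ.toEnv) := by
  classical
  -- Substitute for the free variables one after another.
  have key (F : Finset S.AVar) :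
      HDerivable T (φ.subst fun w => if w ∈ F then θ.toEnv w else Env.id S w) := by
    induction F using Finset.induction_on with
    | empty => simpa using (subst_id φ).symm ▸ h
    | insert t F ht ih =>
      have := (ih.gen t.2).of_taut₂ (HDerivable.all_elim (T := T) t.2 (θ t).2 _)
        fun V hV h₁ h₂ => (hV.imp _ _).1 h₂ h₁
      rw [substOne, subst_subst] at this
      · convert this using 2
        funext w
        by_cases hwF : w ∈ F
        · rw [if_pos hwF, if_pos (Finset.mem_insert_of_mem hwF)]
          exact (subst_of_closed (θ w).2 _).symm
        · rw [if_neg hwF]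
          by_cases hwt : w = t
          · subst hwt
            rw [if_pos (Finset.mem_insert_self _ _)]
            exact (Tup.overwrite_single_self (B := fun α : S.VSrt => HExpr S α.1) _ _ _).symm
          · rw [if_neg (by simp [hwt, hwF])]
            exact (Tup.overwrite_single_of_ne (B := fun α : S.VSrt => HExpr S α.1) _ _ _ hwt).symm
      · intro w _
        by_cases hwF : w ∈ F
        · rw [if_pos hwF, CEnv.toEnv, (θ w).2]
          exact Or.inr (Set.empty_disjoint _)
        · rw [if_neg hwF]
          exact Or.inl rfl
  have := key φ.finite_fv.toFinset
  rwa [subst_congr φ fun w hw => if_pos (φ.finite_fv.mem_toFinset.2 hw)] at this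

theorem hDerivable_ofExpr_iff {φ : Formula S} :
    HDerivable T (ofExpr φ) ↔ Derivable T φ := by
  constructor
  · rintro ⟨F, hF, h⟩
    choose ρ hρ using fun α : S.VSrt => Tup.exists_fresh_point S.var_infinite hF α
    have := h (fun w => ρ w.1) fun w => hρ w.1
    rwa [tr_ofExpr] at this
  · exact fun h => .of_forall fun ρ => by rwa [tr_ofExpr]

theorem HExpr.ofExpr_allSeq : ∀ {σ : List S.VSrt} (z : Tup S.Var σ) (φ : Formula S),
    ofExpr (.allSeq z φ) = allSeq z (ofExpr φ)
  | _, .nil, _ => rfl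
  | _, .cons x z, φ => congrArg (all x) (ofExpr_allSeq z φ)

end Fnl

theorem mainTheorem1 (S : Fnl.Signature.{u}) (T : Set (Fnl.Formula S)) (φ : Fnl.Formula S)
    (h : Fnl.Entails T φ) : Fnl.Derivable T φ := by
  open Fnl in
  obtain ⟨σ, u, hu⟩ := Tup.exists_toList_eq φ.finite_fv.toFinset.toList
  by_contra hφ
  have hχ : ¬ HDerivable T (.ofExpr (.allSeq u φ)) := fun hd =>
    hφ (hDerivable_ofExpr_iff.1 hd).of_allSeq
  -- `V` refutes the universal closure of `φ`; `φ` itself may have free variables, which `V` treats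
  -- like further constants.
  obtain ⟨V, hV, hVχ⟩ := exists_isHenkin (HExpr.wits_ofExpr _) hχ
  obtain ⟨θ, hθ⟩ := hV.exists_cls_eq_choice
  have hmodel : ∀ ψ ∈ T, hV.termStructure.Models ψ := by
    intro ψ hψ σ u _ y
    obtain ⟨d, rfl⟩ := hV.exists_map_cls y
    refine (hV.eval_termStructure hθ ψ σ u d).trans ((hV.cls_eq_tt_iff _).2 ?_)
    exact hV.of_derivable _ ((hDerivable_ofExpr_iff.2 (.premise ψ hψ)).subst_toEnv _)
  refine hVχ ?_
  rw [HExpr.ofExpr_allSeq]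
  refine hV.allSeq u _ fun c => ?_
  have hfv : ∀ w ∈ φ.fv, w ∈ u.toList := by simp [hu]
  have hc := (hV.eval_termStructure hθ φ σ u c).symm.trans
    (h hV.termStructure hmodel σ u hfv (c.map fun _ => hV.cls))
  have := (hV.cls_eq_tt_iff _).1 hc
  rw [HExpr.subst_over_congr _ (by rwa [HExpr.fv_ofExpr]) _ θ.toEnv, ← CEnv.toEnv_over]
  exact this
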